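/- **Setting.** Let $K=K_1\cup\dots\cup K_m$ be a union of finitely many pairwise disjoint simple closed $C^3$ curves in $\mathbf R^n$, let $\gamma_i:\mathbf R\to K_i$ be a unit-speed parametrization, periodic with period the length of $K_i$, with curvature $\kappa=\|\gamma_i''\|$, and let $\mu:K\to(0,\infty)$ be a $C^3$ function; write $\mu(s)=\mu(\gamma_i(s))$ and $\operatorname{grad}\mu(\gamma_i(s))=\mu'(s)\gamma_i'(s)$. Let $NK$ be the normal bundle of $K$, $D(r)=\{(q,w)\in NK:\|w\|<r\}$, $W=\{(q,w)\in NK:\|w\|\,\|\operatorname{grad}\mu(q)\|\le 1\}$, and let $\exp^\mu:W\to\mathbf R^n$ be $$\exp^\mu(q,w)=q-\mu(q)\|w\|^2\operatorname{grad}\mu(q)+\mu(q)\sqrt{1-\|\operatorname{grad}\mu(q)\|^2\|w\|^2}\;w .$$ - $TIR(K,\mu)$ is the supremum of the $r$ such that $D(r)\subset W$ and $\exp^\mu|_{D(r)}$ is a homeomorphism onto its image. - $AIR(K,\mu)$ is the supremum of the $r$ such that $\exp^\mu$ maps some open dense subset of $D(r)$ (contained in $W$) homeomorphically onto an open subset of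 $\mathbf R^n$. - $\tfrac12DCSD(K,\mu)$ is the minimum of $\frac{\|q_1-q_2\|}{\mu(q_1)+\mu(q_2)}$ over the pairs $q_1\ne q_2$ in $K$ that are critical points of $(x,y)\mapsto\|x-y\|^2(\mu(x)+\mu(y))^{-2}$ on $K\times K$. - $FocRad^-(K,\mu)$ is the minimum over the components $K_i$ of $\max\{A_i,B_i\}^{-1/2}$, where $B_i=\max_s|\mu'(s)|^2$ and $A_i$ is the supremum of $\tfrac12(\mu^2)''+\tfrac12\kappa^2\mu^2+\kappa\mu\sqrt{\mu(\mu''+\tfrac14\kappa^2\mu)}$ over those $s$ with $\mu''+\tfrac14\kappa^2\mu>0$. - $UR(K,\mu)=\min\{\tfrac12DCSD(K,\mu),FocRad^-(K,\mu)\}$. Let $S$ be the set of all $r\in(0,UR(K,\mu))$ such that $K$ contains a circular arc $\gamma_i([s_1,s_2])$, $s_1<s_2$, of some curvature $\kappa>0$ along which $\mu(s)=\frac{2}{\kappa r}\cos\left(\frac{\kappa s}{2}+a\right)$ for some $a\in\mathbf R$. **Theorem.** 1. If $TIR(K,\mu)<UR(K,\mu)$, then $S\ne\varnothing$, that is, $K$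 contains a circular arc of some curvature $\kappa$ and positive length along which $\mu=\frac{2}{\kappa r}\cos\left(\frac{\kappa s}{2}+a\right)$ for some $a\in\mathbf R$ and $0<r<UR(K,\mu)$. Whenever $S\ne\varnothing$ (in particular in this case), $TIR(K,\mu)=\inf S$. 2. $S=\varnothing$ if and only if, for every $i$, the set of those $s\in\mathbf R$ with $$\left(\mu''+\tfrac14\kappa^2\mu\right)(s)=0,\quad \kappa'(s)=0,\quad \kappa(s)>0,\quad \gamma_i'''(s)+\kappa^2(s)\gamma_i'(s)=0,$$ $$(\mu')^2(s)-\mu\mu''(s)=\frac1{r^2}\ \text{ for some } 0<r<UR(K,\mu)$$ has empty interior. In that case $TIR(K,\mu)=AIR(K,\mu)=UR(K,\mu)$. -/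

import Mathlib

open scoped ENNReal

namespace NonuniformThickness

/-- Euclidean `n`-space with the Euclidean norm. -/
abbrev E (n : ℕ) : Type := EuclideanSpace ℝ (Fin n)

/-- A union of pairwise disjoint simple closed `C³` curves in `ℝⁿ`, one for each index `i : ι`,
each given by a periodic unit speed parametrization `γ i` whose least period is the length `L i`. -/
structure ClosedCurves (n : ℕ) (ι : Type*) where
  γ : ι → ℝ → E n
  L : ι → ℝ
  length_pos : ∀ i, 0 < L i
  contDiff : ∀ i, ContDiff ℝ 3 (γ i)
  unit_speed : ∀ i s, ‖deriv (γ i) s‖ = 1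
  periodic : ∀ i, Function.Periodic (γ i) (L i)
  simple : ∀ i s t, γ i s = γ i t → ∃ k : ℤ, t = s + k * L i
  disjoint : ∀ i j, i ≠ j → Disjoint (Set.range (γ i)) (Set.range (γ j))

/-- `μ` is a `C³` weight function `K → (0, ∞)`. Only the values of `μ` on the curves matter. -/
structure IsWeight {n : ℕ} {ι : Type*} (K : ClosedCurves n ι) (μ : E n → ℝ) : Prop where
  pos : ∀ i s, 0 < μ (K.γ i s)
  contDiff : ∀ i, ContDiff ℝ 3 (fun s => μ (K.γ i s))

noncomputable section

variable {n : ℕ} {ι : Type*} (K : ClosedCurves n ι) (μ : E n → ℝ)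

/-- The weight as a function of arclength on the `i`-th component. -/
def wt (i : ι) (s : ℝ) : ℝ := μ (K.γ i s)

/-- The curvature `κ = ‖γ''‖` as a function of arclength. -/
def curv (i : ι) (s : ℝ) : ℝ := ‖iteratedDeriv 2 (K.γ i) s‖

/-- The normal bundle `NK`, as a subspace of `ℝⁿ × ℝⁿ`. -/
def NK : Set (E n × E n) :=
  {x | ∃ i s, K.γ i s = x.1 ∧ inner ℝ (deriv (K.γ i) s) x.2 = 0}

open Classical in
/-- The intrinsic gradient of `μ` along `K`: it is `μ'(s) γ'(s)` at `γ(s)`; see `grad_apply`. -/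
def grad (q : E n) : E n :=
  if h : ∃ x : ι × ℝ, K.γ x.1 x.2 = q then
    deriv (wt K μ h.choose.1) h.choose.2 • deriv (K.γ h.choose.1) h.choose.2
  else 0

theorem grad_apply (i : ι) (s : ℝ) :
    grad K μ (K.γ i s) = deriv (wt K μ i) s • deriv (K.γ i) s := by
  have h : ∃ x : ι × ℝ, K.γ x.1 x.2 = K.γ i s := ⟨(i, s), rfl⟩
  rw [grad, dif_pos h]
  have hx := h.choose_spec
  generalize h.choose = x at hx
  obtain ⟨j, t⟩ := x
  simp only at hx ⊢
  have hij : j = i := by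
    by_contra hne
    exact Set.disjoint_left.1 (K.disjoint j i hne) ⟨t, rfl⟩ ⟨s, hx.symm⟩
  subst hij
  obtain ⟨k, rfl⟩ := K.simple j t s hx
  have hp : ∀ u, K.γ j (u + k * K.L j) = K.γ j u := by
    intro u
    exact (K.periodic j).int_mul k u
  congr 1
  · rw [← deriv_comp_add_const]
    congr 1
    funext u
    simp only [wt, hp]
  · rw [← deriv_comp_add_const]
    congr 1
    funext u
    exact (hp u).symm

/-- The domain `W ⊆ NK` of the exponential map. -/
def W : Set (E n × E n) :=
  {x ∈ NK K | ‖grad K μ x.1‖ ≠ 0 → ‖x.2‖ ≤ 1 / ‖grad K μ x.1‖}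

/-- The exponential map `exp^μ` (meaningful on `W` only). -/
def expMu (x : E n × E n) : E n :=
  x.1 - (μ x.1 * ‖x.2‖ ^ 2) • grad K μ x.1
    + (μ x.1 * √(1 - ‖grad K μ x.1‖ ^ 2 * ‖x.2‖ ^ 2)) • x.2

/-- `D(r)`, the vectors of `NK` of length less than `r`. -/
def D (r : ℝ) : Set (E n × E n) := {x ∈ NK K | ‖x.2‖ < r}

/-- The topological injectivity radius: the supremum of the `r` for which `exp^μ` is defined on
`D(r)` and is a homeomorphism from `D(r)` onto its image. -/
def TIR : ℝ≥0∞ :=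
  ⨆ r ∈ {r : ℝ | D K r ⊆ W K μ ∧ Topology.IsEmbedding ((D K r).domRestrict (expMu K μ))},
    ENNReal.ofReal r

/-- The almost injectivity radius: the supremum of the `r` for which `exp^μ` is a homeomorphism
from some relatively open dense subset `U` of `D(r)` onto an open subset of `ℝⁿ`. -/
def AIR : ℝ≥0∞ :=
  ⨆ r ∈ {r : ℝ | ∃ U : Set (E n × E n), U ⊆ W K μ ∧
      (∃ V : Set (E n × E n), IsOpen V ∧ U = D K r ∩ V) ∧ D K r ⊆ closure U ∧
      Topology.IsEmbedding (U.domRestrict (expMu K μ)) ∧ IsOpen (expMu K μ '' U)},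
    ENNReal.ofReal r

/-- `(γ i s, γ j t)` is a double critical pair: two distinct points at which
`Σ(x, y) = ‖x - y‖² (μ x + μ y)⁻²` on `K × K` has vanishing gradient. -/
def IsDoubleCritical (i j : ι) (s t : ℝ) : Prop :=
  K.γ i s ≠ K.γ j t ∧
    HasFDerivAt (fun x : ℝ × ℝ => ‖K.γ i x.1 - K.γ j x.2‖ ^ 2 * ((wt K μ i x.1 + wt K μ j x.2) ^ 2)⁻¹)
      (0 : ℝ × ℝ →L[ℝ] ℝ) (s, t)

/-- `½ DCSD(K, μ)`. -/
def halfDCSD : ℝ≥0∞ :=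
  ⨅ (i : ι) (j : ι) (s : ℝ) (t : ℝ) (_ : IsDoubleCritical K μ i j s t),
    ENNReal.ofReal (‖K.γ i s - K.γ j t‖ / (wt K μ i s + wt K μ j t))

/-- `μ'' + ¼ κ² μ`. -/
def disc (i : ι) (s : ℝ) : ℝ :=
  iteratedDeriv 2 (wt K μ i) s + 1 / 4 * curv K i s ^ 2 * wt K μ i s

/-- `½ (μ²)'' + ½ κ² μ² + κ μ √(μ (μ'' + ¼ κ² μ))`. -/
def focal (i : ι) (s : ℝ) : ℝ :=
  1 / 2 * iteratedDeriv 2 (fun u => wt K μ i u ^ 2) s + 1 / 2 * curv K i s ^ 2 * wt K μ i s ^ 2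
    + curv K i s * wt K μ i s * √(wt K μ i s * disc K μ i s)

/-- `FocRad⁻` of the `i`-th component. -/
def focRadMinusOn (i : ι) : ℝ≥0∞ :=
  (max (⨆ (s : ℝ) (_ : 0 < disc K μ i s), ENNReal.ofReal (focal K μ i s))
    (⨆ s : ℝ, ENNReal.ofReal (|deriv (wt K μ i) s| ^ 2))) ^ (-(1 / 2) : ℝ)

/-- `FocRad⁻(K, μ)`, the minimum over the components. -/
def focRadMinus : ℝ≥0∞ := ⨅ i, focRadMinusOn K μ i

/-- The upper radius `UR(K, μ) = min (½ DCSD) FocRad⁻`. -/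
def UR : ℝ≥0∞ := min (halfDCSD K μ) (focRadMinus K μ)

/-- On `[s₁, s₂]` the unit speed curve `c` runs along a circle of curvature `κ > 0`. -/
def IsCircularArc (c : ℝ → E n) (κ s₁ s₂ : ℝ) : Prop :=
  0 < κ ∧ ∃ o u v : E n, ‖u‖ = 1 ∧ ‖v‖ = 1 ∧ inner ℝ u v = 0 ∧
    ∀ s ∈ Set.Icc s₁ s₂, c s = o + (1 / κ) • (Real.cos (κ * s) • u + Real.sin (κ * s) • v)

/-- The `r ∈ (0, UR)` such that `K` contains a circular arc of positive length, of some curvature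
`κ`, along which `μ = 2 / (κ r) cos (κ s / 2 + a)` for some `a`. -/
def arcRadii : Set ℝ :=
  {r | 0 < r ∧ ENNReal.ofReal r < UR K μ ∧
    ∃ (i : ι) (s₁ s₂ κ a : ℝ), s₁ < s₂ ∧ IsCircularArc (K.γ i) κ s₁ s₂ ∧
      ∀ s ∈ Set.Icc s₁ s₂, wt K μ i s = 2 / (κ * r) * Real.cos (κ * s / 2 + a)}

/-- The parameters on the `i`-th component at which the pointwise compatibility conditions hold. -/
def compatibleSet (i : ι) : Set ℝ :=
  {s | disc K μ i s = 0 ∧ deriv (curv K i) s = 0 ∧ 0 < curv K i s ∧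
    iteratedDeriv 3 (K.γ i) s + curv K i s ^ 2 • deriv (K.γ i) s = 0 ∧
    ∃ r : ℝ, 0 < r ∧ ENNReal.ofReal r < UR K μ ∧
      deriv (wt K μ i) s ^ 2 - wt K μ i s * iteratedDeriv 2 (wt K μ i) s = 1 / r ^ 2}

end

end NonuniformThickness

namespace NonuniformThickness

open Set Filter Topology

/-! Everything is read off from the weighted distance `ratio p s = ‖p - c s‖ / m s`. Below the bound
on `|μ'|`, a vector `w` at `c s` satisfies `expAt s w = p` exactly when `s` is critical for `ratio
p` with value `‖w‖` (`crit_expAt`, `ratio_expAt`, `exists_expAt_eq`). Injectivity of the exponential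
map on `D(r)` thus says that no `p` has two critical points of value below `r`.

At a critical point of value `R` the second derivative is, up to a positive factor, `(y - κmR/2)² -
R² m disc` plus a Cauchy–Schwarz defect, where `y = √(1 - R² m'²)` (`critD_eq_sq`). Below the focal
radii it is positive, except possibly where `disc = 0`. In that degenerate case `disc ≤ 0` nearby,
and there the Wronskian `crit / ‖p - c‖` of `‖p - c‖` and the weight is monotone, so its zeros form
an interval. If the interval is nontrivial, `ratio p` is constant on it, which forces a circular arc
with cosine weight (`hasArc_of_crit_eq_zero`). Hence below all arc radii every critical point is a
strict local minimum and stays isolated when `p` moves (`exists_isolated`).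

Lower bound: suppose some `p` has two critical points of value at most `r`. Such collisions form a
compact family, so one of them has least radius. No motion of `p` may shorten both weighted
distances, so `p` lies on the segment between its two feet and divides it in the ratio of the
weights; the feet are a double critical pair (`Collision.exists_isDoubleCritical`). Below `½ DCSD`
there are therefore no collisions, and compactness gives an embedding.

Upper bound: past the focal radius a critical point with negative second derivative is not a
minimum, and a double critical pair gives two preimages of its dividing point. Both contradict
injectivity. For `AIR` they must survive passing to a dense open set, which is the role of
`AlmostInjective.false_of_disjoint`. On an arc of radius `R` all points have the same weighted
distance `R` from one point of the circle, so `TIR ≤ R`. -/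

/-- A unit speed curve `c` together with a positive weight `m`, and their derivatives. -/
structure WeightedCurve (V : Type*) [NormedAddCommGroup V] [InnerProductSpace ℝ V] where
  c : ℝ → V
  c1 : ℝ → V
  c2 : ℝ → V
  c3 : ℝ → V
  m : ℝ → ℝ
  m1 : ℝ → ℝ
  m2 : ℝ → ℝ
  hc : ∀ s, HasDerivAt c (c1 s) s
  hc1 : ∀ s, HasDerivAt c1 (c2 s) s
  hc2 : ∀ s, HasDerivAt c2 (c3 s) s
  unit_speed : ∀ s, ‖c1 s‖ = 1
  m_pos : ∀ s, 0 < m s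
  hm : ∀ s, HasDerivAt m (m1 s) s
  hm1 : ∀ s, HasDerivAt m1 (m2 s) s
  cont_m2 : Continuous m2

namespace WeightedCurve

variable {V : Type*} [NormedAddCommGroup V] [InnerProductSpace ℝ V] (C : WeightedCurve V)

/-! ### Calculus of the weighted distance along one curve. -/

theorem cont_c : Continuous C.c := continuous_iff_continuousAt.2 fun s => (C.hc s).continuousAt

theorem cont_c1 : Continuous C.c1 := continuous_iff_continuousAt.2 fun s => (C.hc1 s).continuousAt

theorem cont_c2 : Continuous C.c2 := continuous_iff_continuousAt.2 fun s => (C.hc2 s).continuousAt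

theorem cont_m : Continuous C.m := continuous_iff_continuousAt.2 fun s => (C.hm s).continuousAt

theorem cont_m1 : Continuous C.m1 := continuous_iff_continuousAt.2 fun s => (C.hm1 s).continuousAt

/-- The discriminant `m'' + κ² m / 4`. -/
noncomputable def disc (s : ℝ) : ℝ := C.m2 s + 1 / 4 * ‖C.c2 s‖ ^ 2 * C.m s

/-- The inverse square of the first focal radius, where `disc` is positive. -/
noncomputable def focal (s : ℝ) : ℝ :=
  C.m1 s ^ 2 + C.m s * C.m2 s + 1 / 2 * ‖C.c2 s‖ ^ 2 * C.m s ^ 2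
    + ‖C.c2 s‖ * C.m s * √(C.m s * C.disc s)

/-- The weighted distance from `p` to the points of the curve. -/
noncomputable def ratio (p : V) (s : ℝ) : ℝ := ‖p - C.c s‖ / C.m s

/-- A function with the sign of the derivative of `ratio p`. -/
noncomputable def crit (p : V) (s : ℝ) : ℝ :=
  -(inner ℝ (p - C.c s) (C.c1 s) * C.m s) - ‖p - C.c s‖ ^ 2 * C.m1 s

/-- The derivative of `crit p`. -/
noncomputable def critD (p : V) (s : ℝ) : ℝ :=
  C.m s - C.m s * inner ℝ (p - C.c s) (C.c2 s) + inner ℝ (p - C.c s) (C.c1 s) * C.m1 s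
    - ‖p - C.c s‖ ^ 2 * C.m2 s

/-- `R` lies below the focal radii of the curve. -/
def SubFocal (R : ℝ) : Prop :=
  ∀ s, R ^ 2 * C.m1 s ^ 2 < 1 ∧ (0 < C.disc s → R ^ 2 * C.focal s < 1)

theorem cont_disc : Continuous C.disc := by
  have := C.cont_m2; have := C.cont_c2; have := C.cont_m
  unfold disc; fun_prop

theorem cont_focal : Continuous C.focal := by
  have := C.cont_m2; have := C.cont_c2; have := C.cont_m; have := C.cont_disc; have := C.cont_m1
  unfold focal; fun_prop

theorem cont_ratio : Continuous fun x : V × ℝ => C.ratio x.1 x.2 := by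
  have := C.cont_c; have := C.cont_m
  unfold ratio
  exact Continuous.div (by fun_prop) (by fun_prop) fun x => (C.m_pos _).ne'

theorem cont_ratio_left (s : ℝ) : Continuous fun p => C.ratio p s :=
  C.cont_ratio.comp (Continuous.prodMk_left s)

theorem cont_ratio_right (p : V) : Continuous (C.ratio p) :=
  C.cont_ratio.comp (Continuous.prodMk_right p)

theorem cont_crit : Continuous fun x : V × ℝ => C.crit x.1 x.2 := by
  have := C.cont_c; have := C.cont_m; have := C.cont_c1; have := C.cont_m1
  unfold crit; fun_prop

theorem cont_critD : Continuous fun x : V × ℝ => C.critD x.1 x.2 := by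
  have := C.cont_c; have := C.cont_m; have := C.cont_c1; have := C.cont_m1
  have := C.cont_c2; have := C.cont_m2
  unfold critD; fun_prop

theorem inner_c1_c1 (s : ℝ) : inner ℝ (C.c1 s) (C.c1 s) = 1 := by
  rw [real_inner_self_eq_norm_sq, C.unit_speed]; norm_num

theorem inner_c1_c2 (s : ℝ) : inner ℝ (C.c1 s) (C.c2 s) = 0 := by
  have h1 : HasDerivAt (fun s => inner ℝ (C.c1 s) (C.c1 s)) _ s := (C.hc1 s).inner ℝ (C.hc1 s)
  have h2 : (fun s => inner ℝ (C.c1 s) (C.c1 s)) = fun _ => (1 : ℝ) := funext C.inner_c1_c1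
  rw [h2] at h1
  have h3 := h1.unique (hasDerivAt_const s (1 : ℝ))
  rw [real_inner_comm (C.c1 s) (C.c2 s)] at h3
  linarith

theorem hasDerivAt_sub (p : V) (s : ℝ) : HasDerivAt (fun s => p - C.c s) (-C.c1 s) s := by
  simpa using (C.hc s).const_sub p

theorem hasDerivAt_inner_c1 (p : V) (s : ℝ) :
    HasDerivAt (fun s => inner ℝ (p - C.c s) (C.c1 s))
      (inner ℝ (p - C.c s) (C.c2 s) - 1) s := by
  have := (C.hasDerivAt_sub p s).inner ℝ (C.hc1 s)
  refine this.congr_deriv ?_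
  rw [inner_neg_left, C.inner_c1_c1]; ring

theorem hasDerivAt_norm_sq (p : V) (s : ℝ) :
    HasDerivAt (fun s => ‖p - C.c s‖ ^ 2) (-2 * inner ℝ (p - C.c s) (C.c1 s)) s := by
  have := (C.hasDerivAt_sub p s).norm_sq
  refine this.congr_deriv ?_
  rw [inner_neg_right]; ring

theorem hasDerivAt_crit (p : V) (s : ℝ) : HasDerivAt (C.crit p) (C.critD p s) s := by
  have := (((C.hasDerivAt_inner_c1 p s).mul (C.hm s)).neg).sub
    ((C.hasDerivAt_norm_sq p s).mul (C.hm1 s))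
  refine this.congr_deriv ?_
  unfold critD; ring

theorem hasDerivAt_ratio_sq (p : V) (s : ℝ) :
    HasDerivAt (fun s => C.ratio p s ^ 2) (2 * C.crit p s / C.m s ^ 3) s := by
  have h0 := (C.m_pos s).ne'
  have := (C.hasDerivAt_norm_sq p s).div ((C.hm s).pow 2) (pow_ne_zero 2 h0)
  have e : (fun s => C.ratio p s ^ 2) = fun s => ‖p - C.c s‖ ^ 2 / C.m s ^ 2 := by
    funext s; rw [ratio, div_pow]
  rw [e]
  refine this.congr_deriv ?_
  simp only [Pi.pow_apply]
  unfold crit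
  field_simp
  push_cast
  ring

theorem ratio_nonneg (p : V) (s : ℝ) : 0 ≤ C.ratio p s :=
  div_nonneg (norm_nonneg _) (C.m_pos s).le

theorem norm_eq_ratio_mul (p : V) (s : ℝ) : ‖p - C.c s‖ = C.ratio p s * C.m s := by
  rw [ratio, div_mul_cancel₀ _ (C.m_pos s).ne']

theorem crit_eq_zero_iff (p : V) (s : ℝ) :
    C.crit p s = 0 ↔
      inner ℝ (p - C.c s) (C.c1 s) = -(C.m s * C.ratio p s ^ 2 * C.m1 s) := by
  have h0 := (C.m_pos s).ne'
  unfold crit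
  rw [C.norm_eq_ratio_mul]
  constructor
  · intro h
    apply mul_right_cancel₀ h0
    linarith
  · intro h
    rw [h]; ring

theorem crit_eq_zero_of_isLocalMin {p : V} {s : ℝ} (h : IsLocalMin (C.ratio p) s) :
    C.crit p s = 0 := by
  have h2 : IsLocalMin (fun s => C.ratio p s ^ 2) s := by
    filter_upwards [h] with t ht
    exact pow_le_pow_left₀ (C.ratio_nonneg p s) ht 2
  have h3 := h2.hasDerivAt_eq_zero (C.hasDerivAt_ratio_sq p s)
  have h0 := (C.m_pos s).ne'
  rcases div_eq_zero_iff.1 h3 with h | h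
  · linarith
  · exact absurd h (pow_ne_zero 3 h0)

/-! ### The second derivative at a critical point. -/

/-- The component of `p - c s` normal to the curve, at a critical point. -/
theorem norm_normal_sq {p : V} {s : ℝ} (h : C.crit p s = 0) :
    ‖p - C.c s + (C.m s * C.ratio p s ^ 2 * C.m1 s) • C.c1 s‖ ^ 2
      = (C.m s * C.ratio p s) ^ 2 * (1 - C.ratio p s ^ 2 * C.m1 s ^ 2) := by
  rw [norm_add_sq_real, inner_smul_right, (C.crit_eq_zero_iff p s).1 h, norm_smul,
    C.unit_speed, C.norm_eq_ratio_mul, Real.norm_eq_abs, mul_one, sq_abs]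
  ring

theorem critD_eq {p : V} {s : ℝ} (h : C.crit p s = 0) :
    C.critD p s = C.m s * (1 - inner ℝ (p - C.c s) (C.c2 s) - C.ratio p s ^ 2 * C.m1 s ^ 2
      - C.ratio p s ^ 2 * C.m s * C.m2 s) := by
  unfold critD
  rw [(C.crit_eq_zero_iff p s).1 h, C.norm_eq_ratio_mul]
  ring

theorem ratio_sq_mul_le_one {p : V} {s : ℝ} (h : C.crit p s = 0) :
    C.ratio p s ^ 2 * C.m1 s ^ 2 ≤ 1 := by
  have h1 := C.norm_normal_sq h
  rcases (C.ratio_nonneg p s).eq_or_lt with h0 | h0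
  · rw [← h0]; norm_num
  · have : 0 < (C.m s * C.ratio p s) ^ 2 := by have := C.m_pos s; positivity
    nlinarith [sq_nonneg ‖p - C.c s + (C.m s * C.ratio p s ^ 2 * C.m1 s) • C.c1 s‖]

/-- At a critical point, the second derivative is a difference of squares plus the defect in the
Cauchy–Schwarz inequality. -/
theorem critD_eq_sq {p : V} {s : ℝ} (h : C.crit p s = 0) :
    C.critD p s = C.m s * ((√(1 - C.ratio p s ^ 2 * C.m1 s ^ 2)
        - ‖C.c2 s‖ * C.m s * C.ratio p s / 2) ^ 2 - C.ratio p s ^ 2 * (C.m s * C.disc s)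
      + (‖C.c2 s‖ * C.m s * C.ratio p s * √(1 - C.ratio p s ^ 2 * C.m1 s ^ 2)
        - inner ℝ (p - C.c s) (C.c2 s))) := by
  have hy := Real.sq_sqrt (sub_nonneg.2 (C.ratio_sq_mul_le_one h))
  rw [C.critD_eq h]
  unfold disc
  set y := √(1 - C.ratio p s ^ 2 * C.m1 s ^ 2)
  congr 1
  linear_combination -hy

theorem inner_normal_c2 (p : V) (s a : ℝ) :
    inner ℝ (p - C.c s + a • C.c1 s) (C.c2 s) = inner ℝ (p - C.c s) (C.c2 s) := by
  rw [inner_add_left, inner_smul_left, C.inner_c1_c2]; simp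

theorem norm_normal {p : V} {s : ℝ} (h : C.crit p s = 0) :
    ‖p - C.c s + (C.m s * C.ratio p s ^ 2 * C.m1 s) • C.c1 s‖
      = C.m s * C.ratio p s * √(1 - C.ratio p s ^ 2 * C.m1 s ^ 2) := by
  have hy := Real.sq_sqrt (sub_nonneg.2 (C.ratio_sq_mul_le_one h))
  have h1 := C.norm_normal_sq h
  rw [← hy, ← mul_pow] at h1
  have := C.m_pos s; have := C.ratio_nonneg p s
  exact (pow_left_inj₀ (norm_nonneg _) (by positivity) two_ne_zero).1 h1

theorem inner_c2_le {p : V} {s : ℝ} (h : C.crit p s = 0) :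
    inner ℝ (p - C.c s) (C.c2 s)
      ≤ ‖C.c2 s‖ * C.m s * C.ratio p s * √(1 - C.ratio p s ^ 2 * C.m1 s ^ 2) := by
  rw [← C.inner_normal_c2 p s (C.m s * C.ratio p s ^ 2 * C.m1 s)]
  refine (real_inner_le_norm _ _).trans_eq ?_
  rw [C.norm_normal h]; ring

/-- With the square completed, `R² focal < 1` becomes a comparison of `√(1 - R² m'²)` with a
multiple of `R`, the form needed in `critD_eq_sq`. -/
theorem focal_eq {s : ℝ} (h : 0 ≤ C.disc s) :
    C.focal s = C.m1 s ^ 2 + (‖C.c2 s‖ * C.m s / 2 + √(C.m s * C.disc s)) ^ 2 := by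
  have h1 := Real.sq_sqrt (mul_nonneg (C.m_pos s).le h)
  unfold focal
  have h2 : C.m s * C.disc s = C.m s * C.m2 s + 1 / 4 * ‖C.c2 s‖ ^ 2 * C.m s ^ 2 := by
    unfold disc; ring
  generalize √(C.m s * C.disc s) = d at *
  linear_combination -h1 - h2

/-- Below the focal radii the second derivative is positive off the zeros of `disc`. -/
theorem critD_pos_of_disc_ne {p : V} {s : ℝ} (h : C.crit p s = 0)
    (hR : C.ratio p s ^ 2 * C.m1 s ^ 2 < 1 ∧
      (0 < C.disc s → C.ratio p s ^ 2 * C.focal s < 1))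
    (hd : C.disc s ≠ 0) : 0 < C.critD p s := by
  have hm := C.m_pos s
  have hR0 := C.ratio_nonneg p s
  rw [C.critD_eq_sq h]
  have h1 := C.inner_c2_le h
  have hy := Real.sq_sqrt (sub_nonneg.2 (C.ratio_sq_mul_le_one h))
  have hy0 : 0 < √(1 - C.ratio p s ^ 2 * C.m1 s ^ 2) := Real.sqrt_pos.2 (by linarith [hR.1])
  refine mul_pos hm ?_
  set y := √(1 - C.ratio p s ^ 2 * C.m1 s ^ 2)
  set R := C.ratio p s
  rcases lt_or_gt_of_ne hd with hd | hd
  · rcases hR0.eq_or_lt with h0 | h0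
    · rw [← h0] at h1 ⊢
      nlinarith
    · have : R ^ 2 * (C.m s * C.disc s) < 0 :=
        mul_neg_of_pos_of_neg (by positivity) (mul_neg_of_pos_of_neg hm hd)
      nlinarith [sq_nonneg (y - ‖C.c2 s‖ * C.m s * R / 2)]
  · have h2 := hR.2 hd
    rw [C.focal_eq hd.le] at h2
    have h3 := Real.sq_sqrt (mul_pos hm hd).le
    have h4 := Real.sqrt_nonneg (C.m s * C.disc s)
    set d := √(C.m s * C.disc s)
    rw [← h3]
    have hk : 0 ≤ ‖C.c2 s‖ * C.m s / 2 := by positivity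
    set k := ‖C.c2 s‖ * C.m s / 2
    -- This is the square root of `R² focal < 1`. It makes `y - R k > R d ≥ 0`, so the difference of
    -- squares is positive.
    have h5 : R * (k + d) < y := by
      refine lt_of_pow_lt_pow_left₀ 2 hy0.le ?_
      rw [mul_pow, hy]; linarith
    have h6 : 0 ≤ R * d := by positivity
    have h7 : ‖C.c2 s‖ * C.m s * R / 2 = R * k := by simp only [k]; ring
    rw [h7]
    nlinarith

theorem SubFocal.mono {C : WeightedCurve V} {r R : ℝ} (h : C.SubFocal r) (h0 : 0 ≤ R)
    (hR : R ≤ r) : C.SubFocal R := by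
  intro s
  have h2 : R ^ 2 ≤ r ^ 2 := pow_le_pow_left₀ h0 hR 2
  refine ⟨lt_of_le_of_lt (by gcongr) (h s).1, fun hd => ?_⟩
  have : 0 ≤ C.focal s := by rw [C.focal_eq hd.le]; positivity
  exact lt_of_le_of_lt (by gcongr) ((h s).2 hd)

theorem critD_nonneg {p : V} {s : ℝ} (h : C.crit p s = 0) (hd : C.disc s = 0) :
    0 ≤ C.critD p s := by
  rw [C.critD_eq_sq h, hd]
  have h1 := C.inner_c2_le h
  refine mul_nonneg (C.m_pos s).le ?_
  rw [mul_zero, mul_zero, sub_zero]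
  exact add_nonneg (sq_nonneg _) (sub_nonneg.2 h1)

/-- What equality means in the second derivative test. -/
theorem degenerate {p : V} {s : ℝ} (h : C.crit p s = 0) (hR : C.SubFocal (C.ratio p s))
    (hD : C.critD p s ≤ 0) :
    C.disc s = 0 ∧ 0 < ‖C.c2 s‖ ∧ 0 < C.ratio p s ∧
      1 - C.ratio p s ^ 2 * C.m1 s ^ 2 = ‖C.c2 s‖ ^ 2 * C.m s ^ 2 * C.ratio p s ^ 2 / 4 ∧
      p - C.c s = -(C.m s * C.ratio p s ^ 2 * C.m1 s) • C.c1 s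
        + (C.m s ^ 2 * C.ratio p s ^ 2 / 2) • C.c2 s := by
  have hm := C.m_pos s
  have hR0 := C.ratio_nonneg p s
  have hd : C.disc s = 0 := by
    by_contra hd
    exact absurd (C.critD_pos_of_disc_ne h (hR s) hd) (not_lt.2 hD)
  have hy := Real.sq_sqrt (sub_nonneg.2 (C.ratio_sq_mul_le_one h))
  have hy0 : 0 < √(1 - C.ratio p s ^ 2 * C.m1 s ^ 2) :=
    Real.sqrt_pos.2 (by linarith [(hR s).1])
  rw [C.critD_eq_sq h, hd, mul_zero, mul_zero, sub_zero] at hD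
  have h1 := C.inner_c2_le h
  have h2 := nonpos_of_mul_nonpos_right hD hm
  have hn := C.norm_normal h
  have h5 := C.inner_normal_c2 p s (C.m s * C.ratio p s ^ 2 * C.m1 s)
  set y := √(1 - C.ratio p s ^ 2 * C.m1 s ^ 2)
  set R := C.ratio p s
  -- With `disc = 0` the second derivative is a square plus the Cauchy–Schwarz defect, both
  -- nonnegative, so both vanish. Since `y > 0`, this also gives `κ > 0` and `R > 0`.
  have h3 : y = ‖C.c2 s‖ * C.m s * R / 2 := by
    have : (y - ‖C.c2 s‖ * C.m s * R / 2) ^ 2 = 0 :=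
      le_antisymm (by linarith) (sq_nonneg _)
    have := pow_eq_zero_iff two_ne_zero |>.1 this
    linarith
  have h4 : inner ℝ (p - C.c s) (C.c2 s) = ‖C.c2 s‖ * C.m s * R * y :=
    le_antisymm h1 (by nlinarith [sq_nonneg (y - ‖C.c2 s‖ * C.m s * R / 2)])
  have hk : 0 < ‖C.c2 s‖ := by
    rcases (norm_nonneg (C.c2 s)).eq_or_lt with h0 | h0
    · rw [← h0] at h3; linarith
    · exact h0
  have hRp : 0 < R := by
    rcases hR0.eq_or_lt with h0 | h0
    · rw [← h0] at h3; linarith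
    · exact h0
  refine ⟨hd, hk, hRp, ?_, ?_⟩
  · rw [← hy, h3]; ring
  · have h6 := inner_eq_norm_mul_iff_real.1 (show
      -- Equality in Cauchy–Schwarz makes the normal component of `p - c s` a multiple of `c''`.
      inner ℝ (p - C.c s + (C.m s * R ^ 2 * C.m1 s) • C.c1 s) (C.c2 s) = _ * _ by rw [h5, h4, hn]; ring)
    rw [hn, h3] at h6
    have h7 : p - C.c s + (C.m s * R ^ 2 * C.m1 s) • C.c1 s
        = (C.m s ^ 2 * R ^ 2 / 2) • C.c2 s := by
      apply smul_right_injective V hk.ne'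
      simp only
      rw [h6, smul_smul]
      congr 1; ring
    rw [← h7, neg_smul]; abel

/-! ### The comparison of `‖p - c‖` with the weight -/

/-- The Wronskian of `‖p - c‖` and the weight. -/
theorem hasDerivAt_crit_div {p : V} {s : ℝ} (hp : p ≠ C.c s) :
    HasDerivAt (fun s => C.crit p s / ‖p - C.c s‖)
      (C.m s * (‖p - C.c s‖ ^ 2 * (1 - inner ℝ (p - C.c s) (C.c2 s))
          - inner ℝ (p - C.c s) (C.c1 s) ^ 2) / ‖p - C.c s‖ ^ 3
        - ‖p - C.c s‖ * C.m2 s) s := by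
  have h0 : 0 < ‖p - C.c s‖ := norm_pos_iff.2 (sub_ne_zero.2 hp)
  have h1 : HasDerivAt (fun s => ‖p - C.c s‖)
      (-inner ℝ (p - C.c s) (C.c1 s) / ‖p - C.c s‖) s := by
    have := (C.hasDerivAt_norm_sq p s).sqrt (pow_pos h0 2).ne'
    simp only [Real.sqrt_sq (norm_nonneg _)] at this
    refine this.congr_deriv ?_
    field_simp
  refine ((C.hasDerivAt_crit p s).div h1 h0.ne').congr_deriv ?_
  unfold crit critD
  field_simp
  ring

/-- With `ρ = ‖p - c‖`, the quantity is `m ρ'' - ρ m''`. Bounding `⟨p - c, c''⟩` by `b κ`, where `b`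
is the length of the normal component, and completing the square `(b - κρ²/2)²` gives `ρ'' ≥
-κ²ρ/4`, while `disc ≤ 0` says `m'' ≤ -κ²m/4`. -/
theorem wronskian_deriv_nonneg {p : V} {s : ℝ} (hp : p ≠ C.c s) (hd : C.disc s ≤ 0) :
    0 ≤ C.m s * (‖p - C.c s‖ ^ 2 * (1 - inner ℝ (p - C.c s) (C.c2 s))
          - inner ℝ (p - C.c s) (C.c1 s) ^ 2) / ‖p - C.c s‖ ^ 3
        - ‖p - C.c s‖ * C.m2 s := by
  have h0 : 0 < ‖p - C.c s‖ := norm_pos_iff.2 (sub_ne_zero.2 hp)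
  have hm := C.m_pos s
  set a := inner ℝ (p - C.c s) (C.c1 s) with ha
  have hn : ‖p - C.c s - a • C.c1 s‖ ^ 2 = ‖p - C.c s‖ ^ 2 - a ^ 2 := by
    rw [norm_sub_sq_real, inner_smul_right, ← ha, norm_smul, C.unit_speed, Real.norm_eq_abs,
      mul_one, sq_abs]
    ring
  have hi : inner ℝ (p - C.c s) (C.c2 s) ≤ ‖p - C.c s - a • C.c1 s‖ * ‖C.c2 s‖ := by
    have := C.inner_normal_c2 p s (-a)
    rw [← this, neg_smul, ← sub_eq_add_neg]
    exact real_inner_le_norm _ _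
  set b := ‖p - C.c s - a • C.c1 s‖
  set x := inner ℝ (p - C.c s) (C.c2 s)
  set ρ := ‖p - C.c s‖
  unfold disc at hd
  have h1 : -(‖C.c2 s‖ ^ 2 * ρ ^ 4 / 4) ≤ ρ ^ 2 * (1 - x) - a ^ 2 := by
    have : ρ ^ 2 * x ≤ ρ ^ 2 * (b * ‖C.c2 s‖) := by gcongr
    nlinarith [sq_nonneg (b - ‖C.c2 s‖ * ρ ^ 2 / 2)]
  have h2 : -(‖C.c2 s‖ ^ 2 * ρ / 4) * C.m s
      ≤ C.m s * (ρ ^ 2 * (1 - x) - a ^ 2) / ρ ^ 3 := by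
    rw [le_div_iff₀ (by positivity)]
    calc _ = C.m s * (-(‖C.c2 s‖ ^ 2 * ρ ^ 4 / 4)) := by ring
      _ ≤ _ := by gcongr
  nlinarith

/-- Where `disc ≤ 0`, the zeros of `crit p` form an interval. -/
theorem monotoneOn_crit_div {p : V} {a b : ℝ} (hp : ∀ s ∈ Icc a b, p ≠ C.c s)
    (hd : ∀ s ∈ Icc a b, C.disc s ≤ 0) :
    MonotoneOn (fun s => C.crit p s / ‖p - C.c s‖) (Icc a b) := by
  refine monotoneOn_of_hasDerivWithinAt_nonneg (convex_Icc a b)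
    (fun s hs => (C.hasDerivAt_crit_div (hp s hs)).continuousAt.continuousWithinAt)
    (fun s hs => (C.hasDerivAt_crit_div (hp s (interior_subset hs))).hasDerivWithinAt)
    (fun s hs => C.wronskian_deriv_nonneg (hp s (interior_subset hs)) (hd s (interior_subset hs)))

end WeightedCurve

/-! ### Differential equations of circular arcs. -/

theorem eq_of_hasDerivAt_zero {W : Type*} [NormedAddCommGroup W] [NormedSpace ℝ W] {f : ℝ → W}
    {a b : ℝ} (h : ∀ s ∈ Icc a b, HasDerivAt f 0 s) : ∀ s ∈ Icc a b, f s = f a :=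
  constant_of_has_deriv_right_zero (fun s hs => (h s hs).continuousAt.continuousWithinAt)
    fun s hs => (h s (Ico_subset_Icc_self hs)).hasDerivWithinAt

theorem hasDerivAt_unique_of_eqOn_Icc {W : Type*} [NormedAddCommGroup W] [NormedSpace ℝ W]
    {f g : ℝ → W} {f' g' : W} {a b s : ℝ} (hab : a < b) (h : EqOn f g (Icc a b))
    (hs : s ∈ Icc a b) (hf : HasDerivAt f f' s) (hg : HasDerivAt g g' s) : f' = g' :=
  (uniqueDiffOn_Icc hab s hs).eq_deriv _ hf.hasDerivWithinAt
    (hg.hasDerivWithinAt.congr h (h hs))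

/-- Solutions of `f'' = -k² f`. -/
theorem exists_eq_cos_smul_add_sin_smul {W : Type*} [NormedAddCommGroup W] [NormedSpace ℝ W]
    {f f1 : ℝ → W} {a b k : ℝ} (hk : k ≠ 0) (hf : ∀ s ∈ Icc a b, HasDerivAt f (f1 s) s)
    (hf1 : ∀ s ∈ Icc a b, HasDerivAt f1 (-(k ^ 2) • f s) s) :
    ∃ α β : W, ∀ s ∈ Icc a b,
      f s = Real.cos (k * s) • α + Real.sin (k * s) • β ∧
      f1 s = k • (-Real.sin (k * s) • α + Real.cos (k * s) • β) ∧
      α = Real.cos (k * s) • f s - (Real.sin (k * s) / k) • f1 s ∧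
      β = Real.sin (k * s) • f s + (Real.cos (k * s) / k) • f1 s := by
  have hcos : ∀ s, HasDerivAt (fun s => Real.cos (k * s)) (-Real.sin (k * s) * k) s := fun s => by
    simpa using ((hasDerivAt_id s).const_mul k).cos
  have hsin : ∀ s, HasDerivAt (fun s => Real.sin (k * s)) (Real.cos (k * s) * k) s := fun s => by
    simpa using ((hasDerivAt_id s).const_mul k).sin
  have hα := eq_of_hasDerivAt_zero (a := a) (b := b)
    (f := fun s => Real.cos (k * s) • f s - (Real.sin (k * s) / k) • f1 s) (fun s hs => by
      refine (((hcos s).smul (hf s hs)).sub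
        (((hsin s).div_const k).smul (hf1 s hs))).congr_deriv ?_
      match_scalars <;> field_simp <;> ring)
  have hβ := eq_of_hasDerivAt_zero (a := a) (b := b)
    (f := fun s => Real.sin (k * s) • f s + (Real.cos (k * s) / k) • f1 s) (fun s hs => by
      refine (((hsin s).smul (hf s hs)).add
        (((hcos s).div_const k).smul (hf1 s hs))).congr_deriv ?_
      match_scalars <;> field_simp <;> ring)
  refine ⟨_, _, fun s hs => ⟨?_, ?_, (hα s hs).symm, (hβ s hs).symm⟩⟩
  · have h1 := Real.cos_sq_add_sin_sq (k * s)
    rw [← hα s hs, ← hβ s hs]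
    match_scalars
    · linear_combination -h1
    · ring
  · have h1 := Real.cos_sq_add_sin_sq (k * s)
    rw [← hα s hs, ← hβ s hs]
    match_scalars
    · field_simp; linear_combination -h1
    · ring

/-- The sign of `B` is chosen so that `A cos x + B sin x = r cos (x + φ)`. -/
theorem exists_polar {A B r : ℝ} (hr : 0 < r) (h : A ^ 2 + B ^ 2 = r ^ 2) :
    ∃ φ : ℝ, A = r * Real.cos φ ∧ B = -(r * Real.sin φ) := by
  refine ⟨Complex.arg ⟨A, -B⟩, ?_, ?_⟩ <;>
  · have hn : ‖(⟨A, -B⟩ : ℂ)‖ = r := by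
      rw [Complex.norm_def, Complex.normSq_mk, show A * A + -B * -B = r ^ 2 by rw [← h]; ring,
        Real.sqrt_sq hr.le]
    have h1 := Complex.norm_mul_cos_arg ⟨A, -B⟩
    have h2 := Complex.norm_mul_sin_arg ⟨A, -B⟩
    rw [hn] at h1 h2
    simp only at h1 h2
    linarith

namespace WeightedCurve

variable {V : Type*} [NormedAddCommGroup V] [InnerProductSpace ℝ V] (C : WeightedCurve V)

/-- On `[a, b]` the curve is a circular arc of curvature `k`, along which the weight is
`2 / (k R) cos (k s / 2 + φ)`. -/
def HasArc (k R a b : ℝ) : Prop :=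
  0 < k ∧ (∃ o u v : V, ‖u‖ = 1 ∧ ‖v‖ = 1 ∧ inner ℝ u v = 0 ∧ ∀ s ∈ Icc a b,
    C.c s = o + (1 / k) • (Real.cos (k * s) • u + Real.sin (k * s) • v)) ∧
  ∃ φ : ℝ, ∀ s ∈ Icc a b, C.m s = 2 / (k * R) * Real.cos (k * s / 2 + φ)

/-- The tangent solves `f'' = -k² f` and the weight solves `f'' = -(k/2)² f`. The conserved quantity
`m'² - m m''` fixes the amplitude of the weight as `2 / (k R)`. -/
theorem hasArc_of_ode {k R a b : ℝ} (hab : a < b) (hk : 0 < k) (hR : 0 < R)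
    (h2 : ∀ s ∈ Icc a b, ‖C.c2 s‖ = k)
    (h3 : ∀ s ∈ Icc a b, C.c3 s = -(k ^ 2) • C.c1 s)
    (hm2 : ∀ s ∈ Icc a b, C.m2 s = -(k ^ 2 / 4 * C.m s))
    (hmR : ∀ s ∈ Icc a b, C.m1 s ^ 2 - C.m s * C.m2 s = 1 / R ^ 2) : C.HasArc k R a b := by
  have ha : a ∈ Icc a b := left_mem_Icc.2 hab.le
  refine ⟨hk, ?_, ?_⟩
  · obtain ⟨α, β, h⟩ := exists_eq_cos_smul_add_sin_smul hk.ne' (f := C.c1) (f1 := C.c2)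
      (a := a) (b := b) (fun s _ => C.hc1 s) (fun s hs => (C.hc2 s).congr_deriv (h3 s hs))
    have ho := eq_of_hasDerivAt_zero (a := a) (b := b) (f := fun s => C.c s + (1 / k ^ 2) • C.c2 s)
      (fun s hs => by
        refine ((C.hc s).add ((C.hc2 s).const_smul (1 / k ^ 2))).congr_deriv ?_
        rw [h3 s hs]
        match_scalars
        field_simp
        ring)
    have hsc := Real.cos_sq_add_sin_sq (k * a)
    have hα : ‖α‖ ^ 2 = 1 := by
      rw [(h a ha).2.2.1, norm_sub_sq_real, norm_smul, norm_smul, inner_smul_left,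
        inner_smul_right, C.inner_c1_c2, C.unit_speed, h2 a ha, mul_pow, mul_pow,
        Real.norm_eq_abs, Real.norm_eq_abs, sq_abs, sq_abs]
      field_simp
      simp only [mul_zero, sub_zero]
      linear_combination k * hsc
    have hβ : ‖β‖ ^ 2 = 1 := by
      rw [(h a ha).2.2.2, norm_add_sq_real, norm_smul, norm_smul, inner_smul_left,
        inner_smul_right, C.inner_c1_c2, C.unit_speed, h2 a ha, mul_pow, mul_pow,
        Real.norm_eq_abs, Real.norm_eq_abs, sq_abs, sq_abs]
      field_simp
      simp only [mul_zero, add_zero]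
      linear_combination k * hsc
    have hαβ : inner ℝ β α = 0 := by
      rw [(h a ha).2.2.1, (h a ha).2.2.2]
      simp only [inner_add_left, inner_sub_right, inner_smul_left, inner_smul_right,
        C.inner_c1_c2, real_inner_comm (C.c1 a) (C.c2 a), real_inner_self_eq_norm_sq,
        C.unit_speed, h2 a ha]
      simp
      field_simp
      ring
    -- The centre is the constant `c + c'' / k²`. Integrating `c' = cos(ks) α + sin(ks) β` rotates
    -- the frame to `(-β, α)`.
    refine ⟨C.c a + (1 / k ^ 2) • C.c2 a, -β, α, ?_, ?_, ?_, fun s hs => ?_⟩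
    · rw [norm_neg]
      exact (pow_eq_one_iff_of_nonneg (norm_nonneg _) two_ne_zero).1 hβ
    · exact (pow_eq_one_iff_of_nonneg (norm_nonneg _) two_ne_zero).1 hα
    · rw [inner_neg_left, hαβ, neg_zero]
    · have e := ho s hs
      rw [← e, (h s hs).2.1]
      match_scalars <;> field_simp <;> ring
  · have hk2 : k / 2 ≠ 0 := by positivity
    obtain ⟨A, B, h⟩ := exists_eq_cos_smul_add_sin_smul hk2 (f := C.m) (f1 := C.m1)
      (a := a) (b := b) (fun s _ => C.hm s) (fun s hs => (C.hm1 s).congr_deriv (by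
        rw [hm2 s hs, smul_eq_mul]; ring))
    have hsc := Real.cos_sq_add_sin_sq (k / 2 * a)
    have hAB : A ^ 2 + B ^ 2 = (2 / (k * R)) ^ 2 := by
      have h1 := hmR a ha
      rw [hm2 a ha] at h1
      have e : (2 / (k * R)) ^ 2 = 4 / k ^ 2 * (1 / R ^ 2) := by field_simp; norm_num
      rw [e, ← h1, (h a ha).2.2.1, (h a ha).2.2.2]
      simp only [smul_eq_mul]
      generalize Real.cos (k / 2 * a) = x at *
      generalize Real.sin (k / 2 * a) = z at *
      field_simp
      linear_combination (C.m a ^ 2 * k ^ 2 + 2 ^ 2 * C.m1 a ^ 2) * hsc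
    obtain ⟨φ, hA, hB⟩ := exists_polar (by positivity) hAB
    refine ⟨φ, fun s hs => ?_⟩
    rw [(h s hs).1, hA, hB, Real.cos_add, show k * s / 2 = k / 2 * s by ring]
    simp only [smul_eq_mul]
    ring

theorem ratio_eq_of_crit_eq_zero {p : V} {a b : ℝ} (h : ∀ s ∈ Icc a b, C.crit p s = 0) :
    ∀ s ∈ Icc a b, C.ratio p s = C.ratio p a := by
  intro s hs
  have := eq_of_hasDerivAt_zero (fun s hs => by
    have := C.hasDerivAt_ratio_sq p s
    rwa [h s hs, mul_zero, zero_div] at this) s hs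
  exact (pow_left_inj₀ (C.ratio_nonneg _ _) (C.ratio_nonneg _ _) two_ne_zero).1 this

/-- If `ratio p` is constant on an interval, below the focal radii, the curve is an arc there. -/
theorem hasArc_of_crit_eq_zero {p : V} {a b : ℝ} (hab : a < b)
    (h : ∀ s ∈ Icc a b, C.crit p s = 0) (hR : C.SubFocal (C.ratio p a)) :
    0 < C.ratio p a ∧ ∃ k, C.HasArc k (C.ratio p a) a b := by
  have ha : a ∈ Icc a b := left_mem_Icc.2 hab.le
  have hrat := C.ratio_eq_of_crit_eq_zero h
  have hdeg : ∀ s ∈ Icc a b, C.disc s = 0 ∧ 0 < ‖C.c2 s‖ ∧ 0 < C.ratio p a ∧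
      1 - C.ratio p a ^ 2 * C.m1 s ^ 2 = ‖C.c2 s‖ ^ 2 * C.m s ^ 2 * C.ratio p a ^ 2 / 4 ∧
      p - C.c s = -(C.m s * C.ratio p a ^ 2 * C.m1 s) • C.c1 s
        + (C.m s ^ 2 * C.ratio p a ^ 2 / 2) • C.c2 s := by
    intro s hs
    -- One-sided derivatives determine the derivative, so this also covers the endpoints.
    have hD : C.critD p s = 0 := hasDerivAt_unique_of_eqOn_Icc (g := fun _ => (0 : ℝ)) hab h hs
      (C.hasDerivAt_crit p s) (hasDerivAt_const s 0)
    have := C.degenerate (h s hs) (by rwa [hrat s hs]) hD.le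
    rwa [hrat s hs] at this
  have hR0 : 0 < C.ratio p a := (hdeg a ha).2.2.1
  set R := C.ratio p a
  have hm2 : ∀ s ∈ Icc a b, C.m2 s = -(‖C.c2 s‖ ^ 2 / 4 * C.m s) := fun s hs => by
    have := (hdeg s hs).1
    unfold disc at this
    linarith
  -- By degeneracy this function equals `κ² R² / 4`, so its constancy makes the curvature constant.
  have hconst := eq_of_hasDerivAt_zero (a := a) (b := b)
    (f := fun s => (1 - R ^ 2 * C.m1 s ^ 2) / C.m s ^ 2) (fun s hs => by
      have hm := C.m_pos s
      refine (((((C.hm1 s).pow 2).const_mul (R ^ 2)).const_sub 1).div ((C.hm s).pow 2)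
        (pow_ne_zero 2 hm.ne')).congr_deriv ?_
      simp only [Pi.pow_apply]
      rw [(hdeg s hs).2.2.2.1, hm2 s hs]
      field_simp
      push_cast
      ring)
  have hk : ∀ s ∈ Icc a b, ‖C.c2 s‖ = ‖C.c2 a‖ := by
    intro s hs
    have e := hconst s hs
    rw [(hdeg s hs).2.2.2.1, (hdeg a ha).2.2.2.1] at e
    have hm := C.m_pos s
    have hma := C.m_pos a
    field_simp at e
    exact (pow_left_inj₀ (norm_nonneg _) (norm_nonneg _) two_ne_zero).1 (by linarith)
  refine ⟨hR0, ‖C.c2 a‖, C.hasArc_of_ode hab (hdeg a ha).2.1 hR0 hk ?_ ?_ ?_⟩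
  · intro s hs
    have hm := C.m_pos s
    -- Differentiating the formula for `p - c`: the `c''` terms cancel, leaving `c'''` proportional
    -- to `c'`.
    have e := hasDerivAt_unique_of_eqOn_Icc hab (fun s hs => (hdeg s hs).2.2.2.2) hs
      (C.hasDerivAt_sub p s)
      (((((C.hm s).mul_const (R ^ 2)).mul (C.hm1 s)).neg.smul (C.hc1 s)).add
        (((((C.hm s).pow 2).mul_const (R ^ 2)).div_const 2).smul (C.hc2 s)))
    have e2 : (C.m s ^ 2 * R ^ 2 / 2) • C.c3 s
        = (C.m s ^ 2 * R ^ 2 / 2) • (-(‖C.c2 a‖ ^ 2) • C.c1 s) := by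
      have h1 := (hdeg s hs).2.2.2.1
      have h2 := hm2 s hs
      rw [← hk s hs]
      have e3 : (C.m s ^ 2 * R ^ 2 / 2) • C.c3 s = (R ^ 2 * C.m1 s ^ 2 + R ^ 2 * C.m s * C.m2 s - 1)
          • C.c1 s := by
        rw [sub_smul, one_smul, sub_eq_add_neg, e]
        simp only [Pi.neg_apply, Pi.mul_apply, Pi.pow_apply]
        match_scalars <;> push_cast <;> ring
      rw [e3, smul_smul]
      congr 1
      rw [h2]
      linear_combination -h1
    exact smul_right_injective V (by positivity) e2
  · intro s hs
    rw [← hk s hs]; exact hm2 s hs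
  · intro s hs
    have h1 := (hdeg s hs).2.2.2.1
    rw [hm2 s hs, eq_div_iff (by positivity)]
    linear_combination -h1

/-! ### Critical points below the focal radii are strict local minima -/

theorem strictMonoOn_ratio {p : V} {a b : ℝ} (h : ∀ s ∈ Ioo a b, 0 < C.crit p s) :
    StrictMonoOn (C.ratio p) (Icc a b) := by
  have h1 : StrictMonoOn (fun s => C.ratio p s ^ 2) (Icc a b) := by
    refine strictMonoOn_of_hasDerivWithinAt_pos (convex_Icc a b)
      (fun s _ => (C.hasDerivAt_ratio_sq p s).continuousAt.continuousWithinAt)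
      (fun s _ => (C.hasDerivAt_ratio_sq p s).hasDerivWithinAt) fun s hs => ?_
    rw [interior_Icc] at hs
    have := C.m_pos s
    have := h s hs
    positivity
  exact fun s hs t ht hst => lt_of_pow_lt_pow_left₀ 2 (C.ratio_nonneg _ _) (h1 hs ht hst)

theorem strictAntiOn_ratio {p : V} {a b : ℝ} (h : ∀ s ∈ Ioo a b, C.crit p s < 0) :
    StrictAntiOn (C.ratio p) (Icc a b) := by
  have h1 : StrictAntiOn (fun s => C.ratio p s ^ 2) (Icc a b) := by
    refine strictAntiOn_of_hasDerivWithinAt_neg (convex_Icc a b)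
      (fun s _ => (C.hasDerivAt_ratio_sq p s).continuousAt.continuousWithinAt)
      (fun s _ => (C.hasDerivAt_ratio_sq p s).hasDerivWithinAt) fun s hs => ?_
    rw [interior_Icc] at hs
    have := C.m_pos s
    exact div_neg_of_neg_of_pos (by linarith [h s hs]) (by positivity)
  exact fun s hs t ht hst => lt_of_pow_lt_pow_left₀ 2 (C.ratio_nonneg _ _) (h1 hs ht hst)

/-- No arc of the curve has constant weighted distance at most `r` from a point. -/
def NoArc (r : ℝ) : Prop :=
  ∀ p a b, a < b → (∀ s ∈ Icc a b, C.crit p s = 0) → r < C.ratio p a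

/-- At a degenerate point of value `R` one has `R² focal = 1`. Since `R ≤ r < r1`, the inequality
`r1² focal > 1` holds there and, by continuity, nearby, where `SubFocal r1` then rules out `disc >
0`. This is where a margin between `r` and `r1` is needed. -/
theorem disc_nonpos_near {r r1 s0 : ℝ} {p0 : V} (hr : r < r1) (hS : C.SubFocal r1)
    (h : C.crit p0 s0 = 0) (hle : C.ratio p0 s0 ≤ r) (hD : C.critD p0 s0 ≤ 0) :
    ∀ᶠ s in 𝓝 s0, C.disc s ≤ 0 := by
  have h0 := C.ratio_nonneg p0 s0
  obtain ⟨hd, hk, hR, h1, -⟩ := C.degenerate h (hS.mono h0 (by linarith)) hD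
  have hf : 1 < r1 ^ 2 * C.focal s0 := by
    rw [C.focal_eq hd.ge, hd]
    have hm := C.m_pos s0
    have e : C.ratio p0 s0 ^ 2 * (C.m1 s0 ^ 2 + (‖C.c2 s0‖ * C.m s0 / 2) ^ 2) = 1 := by
      linear_combination -h1
    simp only [mul_zero, Real.sqrt_zero, add_zero]
    rw [← e]
    have : C.ratio p0 s0 ^ 2 < r1 ^ 2 := pow_lt_pow_left₀ (by linarith) h0 two_ne_zero
    gcongr
  have hc : Continuous fun s => r1 ^ 2 * C.focal s := C.cont_focal.const_mul _
  filter_upwards [hc.continuousAt.eventually (lt_mem_nhds hf)] with s hs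
  by_contra hds
  exact absurd ((hS s).2 (not_le.1 hds)) (not_lt.2 hs.le)

/-- Near a critical point below the focal radii, `crit` changes sign once. -/
theorem eventually_crit_sign {r r1 s0 : ℝ} {p0 : V} (hr : r < r1) (hS : C.SubFocal r1)
    (hna : C.NoArc r) (h : C.crit p0 s0 = 0) (hle : C.ratio p0 s0 ≤ r) :
    ∃ ε > 0, ∀ᶠ p in 𝓝 p0, ∀ s ∈ Icc (s0 - ε) (s0 + ε), ∀ t ∈ Icc (s0 - ε) (s0 + ε), s < t →
      (C.crit p s = 0 → C.ratio p s ≤ r → 0 < C.crit p t) ∧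
      (C.crit p t = 0 → C.ratio p t ≤ r → C.crit p s < 0) := by
  -- Nondegenerate case: `critD` stays positive near `(p0, s0)`, so `crit p` is strictly increasing.
  by_cases hD : 0 < C.critD p0 s0
  · have h1 : ∀ᶠ x : V × ℝ in 𝓝 p0 ×ˢ 𝓝 s0, 0 < C.critD x.1 x.2 := by
      rw [← nhds_prod_eq]
      exact (C.cont_critD.continuousAt (x := (p0, s0))).eventually (lt_mem_nhds hD)
    obtain ⟨P, hP, Q, hQ, h2⟩ := eventually_prod_iff.1 h1
    obtain ⟨ε, hε, hQε⟩ := Metric.nhds_basis_closedBall.eventually_iff.1 hQ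
    rw [Real.closedBall_eq_Icc] at hQε
    refine ⟨ε, hε, ?_⟩
    filter_upwards [hP] with p hp s hs t ht hst
    have hmono : StrictMonoOn (C.crit p) (Icc (s0 - ε) (s0 + ε)) :=
      strictMonoOn_of_hasDerivWithinAt_pos (convex_Icc _ _)
        (fun s _ => (C.hasDerivAt_crit p s).continuousAt.continuousWithinAt)
        (fun s _ => (C.hasDerivAt_crit p s).hasDerivWithinAt)
        fun s hs => h2 hp (hQε (interior_subset hs))
    have := hmono hs ht hst
    exact ⟨fun e _ => by linarith, fun e _ => by linarith⟩
  -- Degenerate case: the Wronskian is only weakly monotone, but two zeros would give a whole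
  -- interval of zeros, which `NoArc` excludes at values at most `r`.
  · have h0 := C.ratio_nonneg p0 s0
    have hdn := C.disc_nonpos_near hr hS h hle (not_lt.1 hD)
    obtain ⟨-, -, hR, -, -⟩ := C.degenerate h (hS.mono h0 (by linarith)) (not_lt.1 hD)
    have h1 : ∀ᶠ x : V × ℝ in 𝓝 p0 ×ˢ 𝓝 s0, 0 < C.ratio x.1 x.2 := by
      rw [← nhds_prod_eq]
      exact (C.cont_ratio.continuousAt (x := (p0, s0))).eventually (lt_mem_nhds hR)
    obtain ⟨P, hP, Q, hQ, h2⟩ := eventually_prod_iff.1 h1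
    obtain ⟨ε, hε, hQε⟩ := Metric.nhds_basis_closedBall.eventually_iff.1 (hQ.and hdn)
    rw [Real.closedBall_eq_Icc] at hQε
    refine ⟨ε, hε, ?_⟩
    filter_upwards [hP] with p hp s hs t ht hst
    have hne : ∀ u ∈ Icc (s0 - ε) (s0 + ε), p ≠ C.c u := by
      rintro u hu rfl
      have := h2 hp (hQε hu).1
      simp [ratio] at this
    have hmono := C.monotoneOn_crit_div hne (fun u hu => (hQε hu).2)
    have hpos : ∀ u ∈ Icc (s0 - ε) (s0 + ε), 0 < ‖p - C.c u‖ := fun u hu =>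
      norm_pos_iff.2 (sub_ne_zero.2 (hne u hu))
    have hsub : Icc s t ⊆ Icc (s0 - ε) (s0 + ε) := Icc_subset_Icc hs.1 ht.2
    have hst0 : C.crit p s = 0 → C.crit p t = 0 → ∀ u ∈ Icc s t, C.crit p u = 0 := by
      intro e1 e2 u hu
      have a1 := hmono hs (hsub hu) hu.1
      have a2 := hmono (hsub hu) ht hu.2
      simp only [e1, e2, zero_div] at a1 a2
      rcases div_eq_zero_iff.1 (le_antisymm a2 a1) with h | h
      · exact h
      · exact absurd h (hpos u (hsub hu)).ne'
    have hle := hmono hs ht hst.le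
    simp only at hle
    constructor
    · intro e hsr
      rw [e, zero_div] at hle
      have : 0 ≤ C.crit p t := by
        by_contra hn
        exact absurd hle (not_le.2 (div_neg_of_neg_of_pos (not_le.1 hn) (hpos t ht)))
      refine this.lt_of_ne fun e2 => ?_
      exact absurd (hna p s t hst (hst0 e e2.symm)) (not_lt.2 hsr)
    · intro e htr
      rw [e, zero_div] at hle
      have : C.crit p s ≤ 0 := by
        by_contra hn
        exact absurd hle (not_le.2 (div_pos (not_le.1 hn) (hpos s hs)))
      refine this.lt_of_ne fun e2 => ?_
      have := C.ratio_eq_of_crit_eq_zero (hst0 e2 e) t (right_mem_Icc.2 hst.le)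
      exact absurd (hna p s t hst (hst0 e2 e)) (not_lt.2 (this ▸ htr))

/-- A critical point below the focal radii is a strict local minimum, and it is locally the only
critical point, also after moving `p`. -/
theorem exists_isolated {r r1 s0 : ℝ} {p0 : V} (hr : r < r1) (hS : C.SubFocal r1)
    (hna : C.NoArc r) (h : C.crit p0 s0 = 0) (hle : C.ratio p0 s0 ≤ r) :
    ∃ ε > 0, (∀ s ∈ Icc (s0 - ε) (s0 + ε), s ≠ s0 → C.ratio p0 s0 < C.ratio p0 s) ∧
      ∀ᶠ p in 𝓝 p0, ∀ s ∈ Icc (s0 - ε) (s0 + ε), ∀ t ∈ Icc (s0 - ε) (s0 + ε),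
        C.crit p s = 0 → C.ratio p s ≤ r → C.crit p t = 0 → C.ratio p t ≤ r → s = t := by
  obtain ⟨ε, hε, hev⟩ := C.eventually_crit_sign hr hS hna h hle
  refine ⟨ε, hε, fun s hs hne => ?_, ?_⟩
  · have h0 := hev.self_of_nhds
    have hs0 : s0 ∈ Icc (s0 - ε) (s0 + ε) := ⟨by linarith, by linarith⟩
    rcases lt_or_gt_of_ne hne with hlt | hlt
    · exact C.strictAntiOn_ratio (a := s) (b := s0)
        (fun u hu => (h0 u ⟨hs.1.trans hu.1.le, hu.2.le.trans hs0.2⟩ s0 hs0 hu.2).2 h hle)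
        (left_mem_Icc.2 hlt.le) (right_mem_Icc.2 hlt.le) hlt
    · exact C.strictMonoOn_ratio (a := s0) (b := s)
        (fun u hu => (h0 s0 hs0 u ⟨hs0.1.trans hu.1.le, hu.2.le.trans hs.2⟩ hu.1).1 h hle)
        (left_mem_Icc.2 hlt.le) (right_mem_Icc.2 hlt.le) hlt
  · filter_upwards [hev] with p hp s hs t ht es hsr et htr
    rcases lt_trichotomy s t with hlt | heq | hlt
    · exact absurd ((hp s hs t ht hlt).1 es hsr) (by rw [et]; exact lt_irrefl 0)
    · exact heq
    · exact absurd ((hp t ht s hs hlt).1 et htr) (by rw [es]; exact lt_irrefl 0)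

/-- An interior minimum on an interval persists when `p` moves. -/
theorem eventually_exists_crit {α β s0 : ℝ} {p0 : V} (hs : s0 ∈ Ioo α β)
    (hα : C.ratio p0 s0 < C.ratio p0 α) (hβ : C.ratio p0 s0 < C.ratio p0 β) :
    ∀ᶠ p in 𝓝 p0, ∃ s ∈ Ioo α β, C.crit p s = 0 ∧ C.ratio p s ≤ C.ratio p s0 := by
  have hc := C.cont_ratio_left
  filter_upwards [(hc s0).continuousAt.eventually_lt (hc α).continuousAt hα,
    (hc s0).continuousAt.eventually_lt (hc β).continuousAt hβ] with p h1 h2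
  obtain ⟨s, hsm, hmin⟩ := isCompact_Icc.exists_isMinOn (nonempty_Icc.2 (hs.1.trans hs.2).le)
    ((C.cont_ratio_right p).continuousOn (s := Icc α β))
  have hs0 : C.ratio p s ≤ C.ratio p s0 := hmin (Ioo_subset_Icc_self hs)
  have hsI : s ∈ Ioo α β := by
    refine ⟨hsm.1.lt_of_ne ?_, hsm.2.lt_of_ne ?_⟩
    · rintro rfl; exact absurd hs0 (not_le.2 h1)
    · rintro rfl; exact absurd hs0 (not_le.2 h2)
  exact ⟨s, hsI, C.crit_eq_zero_of_isLocalMin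
    (hmin.isLocalMin (Icc_mem_nhds hsI.1 hsI.2)), hs0⟩

end WeightedCurve

/-! ### Metric properties of circular arcs with cosine weight. -/

theorem norm_sq_smul_add_smul {V : Type*} [NormedAddCommGroup V] [InnerProductSpace ℝ V] {u v : V}
    (hu : ‖u‖ = 1) (hv : ‖v‖ = 1) (huv : inner ℝ u v = 0) (x y : ℝ) :
    ‖x • u + y • v‖ ^ 2 = x ^ 2 + y ^ 2 := by
  rw [norm_add_sq_real, inner_smul_left, inner_smul_right, huv, norm_smul, norm_smul, hu, hv,
    Real.norm_eq_abs, Real.norm_eq_abs]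
  simp

/-- The length of a chord of a circle. -/
theorem norm_chord_sq {V : Type*} [NormedAddCommGroup V] [InnerProductSpace ℝ V] {u v : V}
    (hu : ‖u‖ = 1) (hv : ‖v‖ = 1) (huv : inner ℝ u v = 0) (o : V) (k θ η : ℝ) :
    ‖(o + (1 / k) • (Real.cos θ • u + Real.sin θ • v))
      - (o + (1 / k) • (Real.cos η • u + Real.sin η • v))‖ ^ 2
      = (2 / k * Real.sin ((θ - η) / 2)) ^ 2 := by
  have e : (o + (1 / k) • (Real.cos θ • u + Real.sin θ • v))
      - (o + (1 / k) • (Real.cos η • u + Real.sin η • v))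
      = (1 / k * (Real.cos θ - Real.cos η)) • u + (1 / k * (Real.sin θ - Real.sin η)) • v := by
    module
  rw [e, norm_sq_smul_add_smul hu hv huv, Real.cos_sub_cos, Real.sin_sub_sin]
  linear_combination (2 / k * Real.sin ((θ - η) / 2)) ^ 2 * Real.cos_sq_add_sin_sq ((θ + η) / 2)

namespace WeightedCurve

variable {V : Type*} [NormedAddCommGroup V] [InnerProductSpace ℝ V] {C : WeightedCurve V}

/-- All points of an arc have the same weighted distance from a point of its circle. -/
theorem HasArc.exists_ratio_eq {k R a b : ℝ} (h : C.HasArc k R a b) (hR : 0 < R) :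
    ∃ p : V, ∀ s ∈ Icc a b, C.ratio p s = R := by
  obtain ⟨hk, ⟨o, u, v, hu, hv, huv, hc⟩, φ, hm⟩ := h
  -- The point of the circle at which the cosine in the weight would vanish; chords from it have
  -- length `(2 / k) cos (k s / 2 + φ)`.
  refine ⟨o + (1 / k) • (Real.cos (-2 * φ - Real.pi) • u + Real.sin (-2 * φ - Real.pi) • v),
    fun s hs => ?_⟩
  have hms := C.m_pos s
  rw [ratio, div_eq_iff hms.ne']
  refine (pow_left_inj₀ (norm_nonneg _) (by positivity) two_ne_zero).1 ?_
  rw [hc s hs, norm_chord_sq hu hv huv, hm s hs,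
    show (-2 * φ - Real.pi - k * s) / 2 = -(k * s / 2 + φ + Real.pi / 2) by ring,
    Real.sin_neg, Real.sin_add_pi_div_two]
  field_simp

/-- The chord is `(2/k) |sin (x - y)|` and the right side is `(2/k) (cos x + cos y)` with both
cosines positive. It follows that a point dividing the segment between two feet at common value `R`
cannot have those feet joined by an arc of radius `R`. -/
theorem HasArc.norm_sub_lt {k R a b : ℝ} (h : C.HasArc k R a b) (hR : 0 < R) (hab : a ≤ b) :
    ‖C.c a - C.c b‖ < R * (C.m a + C.m b) := by
  obtain ⟨hk, ⟨o, u, v, hu, hv, huv, hc⟩, φ, hm⟩ := h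
  have ha : a ∈ Icc a b := left_mem_Icc.2 hab
  have hb : b ∈ Icc a b := right_mem_Icc.2 hab
  have hma := C.m_pos a
  have hmb := C.m_pos b
  have hcos : ∀ s ∈ Icc a b, 0 < Real.cos (k * s / 2 + φ) := fun s hs => by
    have := C.m_pos s
    rw [hm s hs] at this
    exact pos_of_mul_pos_right this (by positivity)
  refine lt_of_pow_lt_pow_left₀ 2 (by positivity) ?_
  rw [hc a ha, hc b hb, norm_chord_sq hu hv huv, hm a ha, hm b hb,
    show (k * a - k * b) / 2 = (k * a / 2 + φ) - (k * b / 2 + φ) by ring, Real.sin_sub,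
    show R * (2 / (k * R) * Real.cos (k * a / 2 + φ) + 2 / (k * R) * Real.cos (k * b / 2 + φ))
      = 2 / k * (Real.cos (k * a / 2 + φ) + Real.cos (k * b / 2 + φ)) by field_simp,
    mul_pow, mul_pow]
  have h1 := hcos a ha
  have h2 := hcos b hb
  have h3 := Real.cos_sq_add_sin_sq (k * a / 2 + φ)
  have h4 := Real.cos_sq_add_sin_sq (k * b / 2 + φ)
  generalize Real.cos (k * a / 2 + φ) = x at *
  generalize Real.cos (k * b / 2 + φ) = y at *
  generalize Real.sin (k * a / 2 + φ) = z at *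
  generalize Real.sin (k * b / 2 + φ) = w at *
  have hz : |z| < 1 := (sq_lt_one_iff_abs_lt_one _).1 (by nlinarith)
  have hw : |w| < 1 := (sq_lt_one_iff_abs_lt_one _).1 (by nlinarith)
  have hz' := abs_lt.1 hz
  have hw' := abs_lt.1 hw
  have : (z * y - x * w) ^ 2 < (x + y) ^ 2 := sq_lt_sq' (by nlinarith) (by nlinarith)
  gcongr

theorem HasArc.ode {k R a b : ℝ} (h : C.HasArc k R a b) (hR : 0 < R) (hab : a < b) :
    ∀ s ∈ Icc a b, ‖C.c2 s‖ = k ∧ C.c3 s = -(k ^ 2) • C.c1 s ∧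
      C.m2 s = -(k ^ 2 / 4 * C.m s) ∧ C.m1 s ^ 2 - C.m s * C.m2 s = 1 / R ^ 2 := by
  obtain ⟨hk, ⟨o, u, v, hu, hv, huv, hc⟩, φ, hm⟩ := h
  have hcos : ∀ s, HasDerivAt (fun s => Real.cos (k * s)) (-Real.sin (k * s) * k) s := fun s => by
    simpa using ((hasDerivAt_id s).const_mul k).cos
  have hsin : ∀ s, HasDerivAt (fun s => Real.sin (k * s)) (Real.cos (k * s) * k) s := fun s => by
    simpa using ((hasDerivAt_id s).const_mul k).sin
  have hc1 : ∀ s ∈ Icc a b, C.c1 s = -Real.sin (k * s) • u + Real.cos (k * s) • v := fun s hs => by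
    rw [hasDerivAt_unique_of_eqOn_Icc hab hc hs (C.hc s)
      (((((hcos s).smul_const u).add ((hsin s).smul_const v)).const_smul (1 / k)).const_add o)]
    match_scalars <;> field_simp
  have hc2 : ∀ s ∈ Icc a b, C.c2 s = (-k * Real.cos (k * s)) • u + (-k * Real.sin (k * s)) • v :=
    fun s hs => by
    rw [hasDerivAt_unique_of_eqOn_Icc hab hc1 hs (C.hc1 s)
      (((hsin s).neg.smul_const u).add ((hcos s).smul_const v))]
    match_scalars <;> ring
  have hc3 : ∀ s ∈ Icc a b, C.c3 s = -(k ^ 2) • C.c1 s := fun s hs => by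
    rw [hasDerivAt_unique_of_eqOn_Icc hab hc2 hs (C.hc2 s)
      ((((hcos s).const_mul (-k)).smul_const u).add (((hsin s).const_mul (-k)).smul_const v)),
      hc1 s hs]
    match_scalars <;> ring
  have hlin : ∀ s, HasDerivAt (fun s => k * s / 2 + φ) (k / 2) s := fun s => by
    simpa using (((hasDerivAt_id s).const_mul k).div_const 2).add_const φ
  have hm1 : ∀ s ∈ Icc a b, C.m1 s = -(1 / R) * Real.sin (k * s / 2 + φ) := fun s hs => by
    rw [hasDerivAt_unique_of_eqOn_Icc hab hm hs (C.hm s) ((hlin s).cos.const_mul _)]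
    field_simp
  have hm2 : ∀ s ∈ Icc a b, C.m2 s = -(k ^ 2 / 4 * C.m s) := fun s hs => by
    rw [hasDerivAt_unique_of_eqOn_Icc hab hm1 hs (C.hm1 s) ((hlin s).sin.const_mul _), hm s hs]
    field_simp
    ring
  refine fun s hs => ⟨?_, hc3 s hs, hm2 s hs, ?_⟩
  · refine (pow_left_inj₀ (norm_nonneg _) hk.le two_ne_zero).1 ?_
    rw [hc2 s hs, norm_sq_smul_add_smul hu hv huv]
    linear_combination k ^ 2 * Real.cos_sq_add_sin_sq (k * s)
  · have h1 := Real.cos_sq_add_sin_sq (k * s / 2 + φ)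
    rw [hm2 s hs, hm s hs, hm1 s hs]
    generalize Real.cos (k * s / 2 + φ) = x at *
    generalize Real.sin (k * s / 2 + φ) = z at *
    field_simp
    linear_combination 4 * h1

variable (C)

/-! ### The exponential map along one curve -/

/-- The exponential map in terms of the parameter. -/
noncomputable def expAt (s : ℝ) (w : V) : V :=
  C.c s - (C.m s * ‖w‖ ^ 2) • (C.m1 s • C.c1 s) + (C.m s * √(1 - C.m1 s ^ 2 * ‖w‖ ^ 2)) • w

theorem expAt_sub (s : ℝ) (w : V) :
    C.expAt s w - C.c s
      = -(C.m s * ‖w‖ ^ 2 * C.m1 s) • C.c1 s + (C.m s * √(1 - C.m1 s ^ 2 * ‖w‖ ^ 2)) • w := by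
  unfold expAt; module

theorem ratio_expAt {s : ℝ} {w : V} (hw : inner ℝ (C.c1 s) w = 0)
    (h : C.m1 s ^ 2 * ‖w‖ ^ 2 ≤ 1) : C.ratio (C.expAt s w) s = ‖w‖ := by
  have hm := C.m_pos s
  rw [ratio, div_eq_iff hm.ne']
  refine (pow_left_inj₀ (norm_nonneg _) (by positivity) two_ne_zero).1 ?_
  rw [expAt_sub, norm_add_sq_real, inner_smul_left, inner_smul_right, hw, norm_smul, norm_smul,
    C.unit_speed, mul_pow, mul_pow, Real.norm_eq_abs, Real.norm_eq_abs, sq_abs, sq_abs,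
    mul_pow _ (√_), Real.sq_sqrt (by linarith)]
  ring

theorem crit_expAt {s : ℝ} {w : V} (hw : inner ℝ (C.c1 s) w = 0)
    (h : C.m1 s ^ 2 * ‖w‖ ^ 2 ≤ 1) : C.crit (C.expAt s w) s = 0 := by
  rw [crit_eq_zero_iff, C.ratio_expAt hw h, expAt_sub, inner_add_left, inner_smul_left,
    inner_smul_left, C.inner_c1_c1, real_inner_comm, hw]
  simp

/-- The vector is the normal component of `p - c s` divided by `m √(1 - R² m'²)`; strictness in the
hypothesis keeps the divisor nonzero. -/
theorem exists_expAt_eq {p : V} {s : ℝ} (hp : C.crit p s = 0)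
    (h : C.ratio p s ^ 2 * C.m1 s ^ 2 < 1) :
    ∃ w, inner ℝ (C.c1 s) w = 0 ∧ ‖w‖ = C.ratio p s ∧ C.expAt s w = p := by
  have hm := C.m_pos s
  have hn := C.norm_normal hp
  have hi := (C.crit_eq_zero_iff p s).1 hp
  have hy : 0 < √(1 - C.ratio p s ^ 2 * C.m1 s ^ 2) := Real.sqrt_pos.2 (by linarith)
  have hw : ‖(C.m s * √(1 - C.ratio p s ^ 2 * C.m1 s ^ 2))⁻¹ •
      (p - C.c s + (C.m s * C.ratio p s ^ 2 * C.m1 s) • C.c1 s)‖ = C.ratio p s := by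
    rw [norm_smul, hn, Real.norm_of_nonneg (by positivity)]
    field_simp
  refine ⟨_, ?_, hw, ?_⟩
  · rw [inner_smul_right, inner_add_right, inner_smul_right, C.inner_c1_c1, real_inner_comm, hi]
    ring
  · rw [expAt, hw, mul_comm (C.m1 s ^ 2), smul_smul (C.m s * √_), mul_inv_cancel₀ (by positivity)]
    module

theorem expAt_injective {s : ℝ} {w w' : V} (hw : inner ℝ (C.c1 s) w = 0)
    (hw' : inner ℝ (C.c1 s) w' = 0) (h : C.m1 s ^ 2 * ‖w‖ ^ 2 < 1)
    (h' : C.m1 s ^ 2 * ‖w'‖ ^ 2 < 1) (he : C.expAt s w = C.expAt s w') : w = w' := by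
  have hm := C.m_pos s
  have hn : ‖w‖ = ‖w'‖ := by rw [← C.ratio_expAt hw h.le, he, C.ratio_expAt hw' h'.le]
  have hy : 0 < √(1 - C.m1 s ^ 2 * ‖w'‖ ^ 2) := Real.sqrt_pos.2 (by linarith)
  unfold expAt at he
  rw [hn] at he
  exact smul_right_injective V (by positivity : C.m s * √(1 - C.m1 s ^ 2 * ‖w'‖ ^ 2) ≠ 0)
    (add_left_cancel he)

theorem exists_ratio_lt_of_critD_neg {p : V} {s : ℝ} (h : C.crit p s = 0) (hD : C.critD p s < 0) :
    ∃ t, C.ratio p t < C.ratio p s := by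
  have h1 : ∀ᶠ t in 𝓝 s, C.critD p t < 0 :=
    (C.cont_critD.comp (Continuous.prodMk_right p)).continuousAt.eventually (gt_mem_nhds hD)
  obtain ⟨ε, hε, hb⟩ := Metric.nhds_basis_closedBall.eventually_iff.1 h1
  rw [Real.closedBall_eq_Icc] at hb
  have hanti : StrictAntiOn (C.crit p) (Icc s (s + ε)) :=
    strictAntiOn_of_hasDerivWithinAt_neg (convex_Icc _ _)
      (fun s _ => (C.hasDerivAt_crit p s).continuousAt.continuousWithinAt)
      (fun s _ => (C.hasDerivAt_crit p s).hasDerivWithinAt)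
      fun t ht => hb ⟨by linarith [(interior_subset ht).1], (interior_subset ht).2⟩
  have hs : s ∈ Icc s (s + ε) := left_mem_Icc.2 (by linarith)
  refine ⟨s + ε, C.strictAntiOn_ratio (a := s) (b := s + ε) (fun t ht => ?_) hs
    (right_mem_Icc.2 (by linarith)) (by linarith)⟩
  have := hanti hs (Ioo_subset_Icc_self ht) ht.1
  rwa [h] at this

/-- Beyond the focal radius, some critical point is not a minimum. -/
theorem exists_not_min_of_focal {r s : ℝ} (hr : 0 < r) (hd : 0 < C.disc s)
    (hf : 1 < r ^ 2 * C.focal s) {N : V} (hN : ‖N‖ = 1) (hN1 : inner ℝ (C.c1 s) N = 0) :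
    ∃ w, inner ℝ (C.c1 s) w = 0 ∧ ‖w‖ < r ∧ C.m1 s ^ 2 * ‖w‖ ^ 2 < 1 ∧
      ∃ t, C.ratio (C.expAt s w) t < ‖w‖ := by
  have hm := C.m_pos s
  -- Along the direction of `c''` the Cauchy–Schwarz defect vanishes; if `c'' = 0`, any unit normal
  -- has this property.
  obtain ⟨N, hN, hN1, hN2⟩ : ∃ N : V, ‖N‖ = 1 ∧ inner ℝ (C.c1 s) N = 0 ∧
      inner ℝ N (C.c2 s) = ‖C.c2 s‖ := by
    by_cases hk : C.c2 s = 0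
    · exact ⟨N, hN, hN1, by rw [hk]; simp⟩
    · have hk' : ‖C.c2 s‖ ≠ 0 := norm_ne_zero_iff.2 hk
      refine ⟨‖C.c2 s‖⁻¹ • C.c2 s, ?_, ?_, ?_⟩
      · rw [norm_smul, norm_inv, norm_norm, inv_mul_cancel₀ hk']
      · rw [inner_smul_right, C.inner_c1_c2, mul_zero]
      · rw [inner_smul_left, real_inner_self_eq_norm_sq]
        simp
        field_simp
  have hdd : 0 < √(C.m s * C.disc s) := Real.sqrt_pos.2 (mul_pos hm hd)
  have hd2 := Real.sq_sqrt (mul_pos hm hd).le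
  rw [C.focal_eq hd.le] at hf
  set d := √(C.m s * C.disc s)
  have hk : 0 ≤ ‖C.c2 s‖ * C.m s / 2 := by positivity
  set k := ‖C.c2 s‖ * C.m s / 2 with hkdef
  have h1 : √(1 / r ^ 2 - C.m1 s ^ 2) < k + d := by
    refine (Real.sqrt_lt' (by positivity)).2 ?_
    rw [sub_lt_iff_lt_add', div_lt_iff₀ (by positivity)]
    linarith
  -- With `R = 1 / √(m'² + z²)` one gets `√(1 - R² m'²) = R z`, and the second derivative is `m R²
  -- (z - k - d) (z - k + d)`. Taking `z` between `k - d` and `k + d` makes it negative, and `z >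
  -- √(1/r² - m'²)` makes `R < r`.
  obtain ⟨z, hz1, hz2⟩ := exists_between
    (max_lt (max_lt (by linarith : k - d < k + d) (by positivity : (0 : ℝ) < k + d)) h1)
  obtain ⟨hz3, hz5⟩ := max_lt_iff.1 hz1
  obtain ⟨hz3, hz4⟩ := max_lt_iff.1 hz3
  have hq : 0 < C.m1 s ^ 2 + z ^ 2 := by positivity
  set R := (√(C.m1 s ^ 2 + z ^ 2))⁻¹ with hRdef
  have hR0 : 0 < R := inv_pos.2 (Real.sqrt_pos.2 hq)
  have hR2 : R ^ 2 * (C.m1 s ^ 2 + z ^ 2) = 1 := by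
    rw [hRdef, inv_pow, Real.sq_sqrt hq.le, inv_mul_cancel₀ hq.ne']
  have hwn : ‖R • N‖ = R := by rw [norm_smul, hN, Real.norm_of_nonneg hR0.le, mul_one]
  have hw1 : inner ℝ (C.c1 s) (R • N) = 0 := by rw [inner_smul_right, hN1, mul_zero]
  have hlt : C.m1 s ^ 2 * R ^ 2 < 1 := by
    have : 0 < R ^ 2 * z ^ 2 := by positivity
    nlinarith
  have hy : √(1 - C.m1 s ^ 2 * R ^ 2) = R * z := by
    rw [show 1 - C.m1 s ^ 2 * R ^ 2 = (R * z) ^ 2 by linear_combination -hR2]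
    exact Real.sqrt_sq (by positivity)
  have hRr : R < r := by
    have h2 := (Real.sqrt_lt' hz4).1 hz5
    have h3 : 1 / r ^ 2 < C.m1 s ^ 2 + z ^ 2 := by linarith
    rw [div_lt_iff₀ (by positivity)] at h3
    refine lt_of_pow_lt_pow_left₀ 2 hr.le ?_
    refine lt_of_mul_lt_mul_right ?_ hq.le
    rw [hR2]; linarith
  have hle : C.m1 s ^ 2 * ‖R • N‖ ^ 2 ≤ 1 := by rw [hwn]; exact hlt.le
  have hcr := C.crit_expAt hw1 hle
  have hra := C.ratio_expAt hw1 hle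
  refine ⟨R • N, hw1, by rwa [hwn], by rwa [hwn], ?_⟩
  rw [← hra]
  refine C.exists_ratio_lt_of_critD_neg hcr ?_
  rw [C.critD_eq_sq hcr, hra, expAt_sub, hwn, mul_comm (R ^ 2) (C.m1 s ^ 2), hy]
  have hin : inner ℝ (-(C.m s * R ^ 2 * C.m1 s) • C.c1 s + (C.m s * (R * z)) • R • N) (C.c2 s)
      = ‖C.c2 s‖ * C.m s * R * (R * z) := by
    rw [inner_add_left, inner_smul_left, inner_smul_left, inner_smul_left, C.inner_c1_c2, hN2]
    simp
    ring
  rw [hin, ← hd2]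
  have e : (R * z - ‖C.c2 s‖ * C.m s * R / 2) ^ 2 - R ^ 2 * d ^ 2
      + (‖C.c2 s‖ * C.m s * R * (R * z) - ‖C.c2 s‖ * C.m s * R * (R * z))
      = R ^ 2 * ((z - k - d) * (z - k + d)) := by
    rw [hkdef]; ring
  rw [e]
  refine mul_neg_of_pos_of_neg hm (mul_neg_of_pos_of_neg (by positivity)
    (mul_neg_of_neg_of_pos (by linarith) (by linarith)))

end WeightedCurve

/-! ### The components of `K` as weighted curves. -/

section Setup

variable {n : ℕ} {ι : Type*} {K : ClosedCurves n ι} {μ : E n → ℝ}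

theorem hasDerivAt_deriv_of_contDiff {W : Type*} [NormedAddCommGroup W] [NormedSpace ℝ W]
    {f : ℝ → W} (hf : ContDiff ℝ 3 f) (s : ℝ) :
    HasDerivAt f (deriv f s) s ∧ HasDerivAt (deriv f) (iteratedDeriv 2 f s) s ∧
      HasDerivAt (iteratedDeriv 2 f) (iteratedDeriv 3 f s) s := by
  refine ⟨(hf.differentiable (by norm_num) s).hasDerivAt, ?_, ?_⟩
  · have := (hf.differentiable_iteratedDeriv 1 (by norm_num) s).hasDerivAt
    rw [← iteratedDeriv_succ] at this
    rwa [iteratedDeriv_one] at this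
  · have := (hf.differentiable_iteratedDeriv 2 (by norm_cast) s).hasDerivAt
    rwa [← iteratedDeriv_succ] at this

/-- The `i`-th component with its weight. -/
noncomputable def IsWeight.curve (hμ : IsWeight K μ) (i : ι) : WeightedCurve (E n) where
  c := K.γ i
  c1 := deriv (K.γ i)
  c2 := iteratedDeriv 2 (K.γ i)
  c3 := iteratedDeriv 3 (K.γ i)
  m := wt K μ i
  m1 := deriv (wt K μ i)
  m2 := iteratedDeriv 2 (wt K μ i)
  hc s := (hasDerivAt_deriv_of_contDiff (K.contDiff i) s).1
  hc1 s := (hasDerivAt_deriv_of_contDiff (K.contDiff i) s).2.1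
  hc2 s := (hasDerivAt_deriv_of_contDiff (K.contDiff i) s).2.2
  unit_speed := K.unit_speed i
  m_pos := hμ.pos i
  hm s := (hasDerivAt_deriv_of_contDiff (hμ.contDiff i) s).1
  hm1 s := (hasDerivAt_deriv_of_contDiff (hμ.contDiff i) s).2.1
  cont_m2 := (hμ.contDiff i).continuous_iteratedDeriv 2 (by norm_cast)

variable (hμ : IsWeight K μ)

theorem disc_eq (i : ι) (s : ℝ) : disc K μ i s = (hμ.curve i).disc s := rfl

theorem focal_eq (i : ι) (s : ℝ) : focal K μ i s = (hμ.curve i).focal s := by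
  have h : iteratedDeriv 2 (fun u => wt K μ i u ^ 2) s
      = 2 * (deriv (wt K μ i) s ^ 2 + wt K μ i s * iteratedDeriv 2 (wt K μ i) s) := by
    have h1 : deriv (fun u => wt K μ i u ^ 2) = fun u => 2 * (wt K μ i u * deriv (wt K μ i) u) := by
      funext u
      refine (((hμ.curve i).hm u).pow 2).deriv.trans ?_
      simp only [IsWeight.curve]
      push_cast
      ring
    rw [iteratedDeriv_succ, iteratedDeriv_one, h1]
    refine ((((hμ.curve i).hm s).mul ((hμ.curve i).hm1 s)).const_mul 2).deriv.trans ?_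
    simp only [IsWeight.curve]
    ring
  unfold focal WeightedCurve.focal
  rw [h, disc_eq hμ]
  simp only [IsWeight.curve, curv]
  ring

theorem eq_of_gamma_eq {i j : ι} {s t : ℝ} (h : K.γ i s = K.γ j t) :
    i = j ∧ ∃ k : ℤ, t = s + k * K.L i := by
  have hij : i = j := by
    by_contra hne
    exact Set.disjoint_left.1 (K.disjoint i j hne) ⟨s, rfl⟩ ⟨t, h.symm⟩
  subst hij
  exact ⟨rfl, K.simple i s t h⟩

theorem periodic_deriv {W : Type*} [NormedAddCommGroup W] [NormedSpace ℝ W] {f : ℝ → W} {L : ℝ}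
    (h : Function.Periodic f L) : Function.Periodic (deriv f) L := by
  intro s
  rw [← deriv_comp_add_const]
  congr 1
  funext u
  exact h u

theorem periodic_wt (i : ι) : Function.Periodic (wt K μ i) (K.L i) := fun s => by
  simp only [wt, K.periodic i s]

theorem periodic_ratio (i : ι) (p : E n) : Function.Periodic ((hμ.curve i).ratio p) (K.L i) :=
  fun s => by
  simp only [WeightedCurve.ratio, IsWeight.curve, K.periodic i s, periodic_wt i s]

theorem periodic_crit (i : ι) (p : E n) : Function.Periodic ((hμ.curve i).crit p) (K.L i) :=
  fun s => by
  simp only [WeightedCurve.crit, IsWeight.curve, K.periodic i s, periodic_wt i s,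
    periodic_deriv (K.periodic i) s, periodic_deriv (periodic_wt (μ := μ) i) s]

/-- The parameter can be moved into a fundamental interval. -/
theorem exists_mem_Icc (i : ι) (s : ℝ) : ∃ t ∈ Icc 0 (K.L i), K.γ i t = K.γ i s ∧
    ∀ p, (hμ.curve i).ratio p t = (hμ.curve i).ratio p s ∧
      (hμ.curve i).crit p t = (hμ.curve i).crit p s := by
  obtain ⟨k, hk, -⟩ := existsUnique_add_zsmul_mem_Ico (K.length_pos i) s 0
  rw [zero_add] at hk
  refine ⟨_, Ico_subset_Icc_self hk, ?_, fun p => ⟨?_, ?_⟩⟩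
  · exact (K.periodic i).zsmul k s
  · exact (periodic_ratio hμ i p).zsmul k s
  · exact (periodic_crit hμ i p).zsmul k s

/-! ### The exponential map -/

/-- Membership in `NK` supplies some parameter of the base point; by simplicity and periodicity
normality holds at every other one. -/
theorem inner_deriv_of_mem_NK {x : E n × E n} (hx : x ∈ NK K) {i : ι} {s : ℝ}
    (h : K.γ i s = x.1) : inner ℝ ((hμ.curve i).c1 s) x.2 = 0 := by
  obtain ⟨j, t, h1, h2⟩ := hx
  obtain ⟨rfl, k, rfl⟩ := eq_of_gamma_eq (h.trans h1.symm)
  have := (periodic_deriv (K.periodic i)).int_mul k s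
  rw [this] at h2
  exact h2

theorem norm_grad (i : ι) (s : ℝ) : ‖grad K μ (K.γ i s)‖ = |(hμ.curve i).m1 s| := by
  rw [grad_apply, norm_smul, K.unit_speed, mul_one]; rfl

theorem expMu_eq (i : ι) (s : ℝ) (w : E n) :
    expMu K μ (K.γ i s, w) = (hμ.curve i).expAt s w := by
  simp only [expMu, WeightedCurve.expAt, norm_grad hμ, sq_abs]
  rw [grad_apply]
  rfl

theorem mem_W_iff {x : E n × E n} (hx : x ∈ NK K) {i : ι} {s : ℝ} (h : K.γ i s = x.1) :
    x ∈ W K μ ↔ (hμ.curve i).m1 s ^ 2 * ‖x.2‖ ^ 2 ≤ 1 := by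
  simp only [W, mem_ofPred_eq, hx, true_and, ← h, norm_grad hμ]
  rw [← sq_abs ((hμ.curve i).m1 s), ← mul_pow, sq_le_one_iff₀ (by positivity)]
  rcases (abs_nonneg ((hμ.curve i).m1 s)).eq_or_lt with h0 | h0
  · simp [← h0]
  · rw [le_div_iff₀ h0, mul_comm]
    exact ⟨fun h => h h0.ne', fun h _ => h⟩

/-- Vectors shorter than `r` lie in the domain of the exponential map. -/
def Admissible (r : ℝ) : Prop := ∀ i s, r ^ 2 * (hμ.curve i).m1 s ^ 2 ≤ 1

theorem Admissible.lt_one {r : ℝ} (h : Admissible hμ r) {w : E n} (hw : ‖w‖ < r) (i : ι) (s : ℝ) :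
    (hμ.curve i).m1 s ^ 2 * ‖w‖ ^ 2 < 1 := by
  have h1 := h i s
  have h2 : ‖w‖ ^ 2 < r ^ 2 := pow_lt_pow_left₀ hw (norm_nonneg _) two_ne_zero
  rcases (sq_nonneg ((hμ.curve i).m1 s)).eq_or_lt with h0 | h0
  · rw [← h0]; norm_num
  · nlinarith

theorem Admissible.subset_W {r : ℝ} (h : Admissible hμ r) : D K r ⊆ W K μ := by
  rintro x ⟨hx, hxr⟩
  obtain ⟨i, s, h1, -⟩ := id hx
  exact (mem_W_iff hμ hx h1).2 (h.lt_one hμ hxr i s).le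

/-- Together with `exists_expMu_eq` this translates preimages under the exponential map into
critical points of the weighted distance and back. -/
theorem crit_expMu {x : E n × E n} (hx : x ∈ W K μ) {i : ι} {s : ℝ} (h : K.γ i s = x.1) :
    (hμ.curve i).crit (expMu K μ x) s = 0 ∧ (hμ.curve i).ratio (expMu K μ x) s = ‖x.2‖ := by
  have h1 := inner_deriv_of_mem_NK hμ hx.1 h
  have h2 := (mem_W_iff hμ hx.1 h).1 hx
  obtain ⟨q, w⟩ := x
  simp only at h h1 h2 ⊢
  subst h
  rw [expMu_eq hμ]
  exact ⟨WeightedCurve.crit_expAt _ h1 h2, WeightedCurve.ratio_expAt _ h1 h2⟩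

theorem exists_expMu_eq {r : ℝ} (h : Admissible hμ r) {p : E n} {i : ι} {s : ℝ}
    (hp : (hμ.curve i).crit p s = 0) (hr : (hμ.curve i).ratio p s < r) :
    ∃ x ∈ D K r, x.1 = K.γ i s ∧ ‖x.2‖ = (hμ.curve i).ratio p s ∧ expMu K μ x = p := by
  have h0 := (hμ.curve i).ratio_nonneg p s
  have h1 : (hμ.curve i).ratio p s ^ 2 * (hμ.curve i).m1 s ^ 2 < 1 := by
    have h1 := h i s
    have h2 := pow_lt_pow_left₀ hr h0 two_ne_zero
    rcases (sq_nonneg ((hμ.curve i).m1 s)).eq_or_lt with h0 | h0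
    · rw [← h0]; norm_num
    · nlinarith
  obtain ⟨w, hw, hwn, hwe⟩ := (hμ.curve i).exists_expAt_eq hp h1
  refine ⟨(K.γ i s, w), ⟨⟨i, s, rfl, hw⟩, by rwa [hwn]⟩, rfl, hwn, ?_⟩
  rw [expMu_eq hμ, hwe]

theorem expMu_injective {r : ℝ} (h : Admissible hμ r) {x y : E n × E n} (hx : x ∈ D K r)
    (hy : y ∈ D K r) (hxy : x.1 = y.1) (he : expMu K μ x = expMu K μ y) : x = y := by
  obtain ⟨i, s, h1, -⟩ := id hx.1
  have ix := inner_deriv_of_mem_NK hμ hx.1 h1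
  have iy := inner_deriv_of_mem_NK hμ hy.1 (h1.trans hxy)
  have nx := h.lt_one hμ hx.2 i s
  have ny := h.lt_one hμ hy.2 i s
  obtain ⟨q, w⟩ := x
  obtain ⟨q', w'⟩ := y
  simp only at hxy h1 ix iy nx ny
  subst hxy
  subst h1
  rw [expMu_eq hμ, expMu_eq hμ] at he
  rw [(hμ.curve i).expAt_injective ix iy nx ny he]

/-! ### The focal radii -/

theorem ofReal_lt_rpow_neg_half {r : ℝ} (hr : 0 < r) (x : ℝ≥0∞) :
    ENNReal.ofReal r < x ^ (-(1 / 2) : ℝ) ↔ x < ENNReal.ofReal (1 / r ^ 2) := by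
  rw [ENNReal.rpow_neg, ENNReal.lt_inv_iff_lt_inv, one_div, ENNReal.rpow_inv_lt_iff two_pos,
    ← ENNReal.ofReal_inv_of_pos hr, ENNReal.ofReal_rpow_of_pos (by positivity)]
  norm_num

theorem rpow_neg_half_lt_ofReal {r : ℝ} (hr : 0 < r) (x : ℝ≥0∞) :
    x ^ (-(1 / 2) : ℝ) < ENNReal.ofReal r ↔ ENNReal.ofReal (1 / r ^ 2) < x := by
  rw [ENNReal.rpow_neg, ENNReal.inv_lt_iff_inv_lt, one_div, ENNReal.lt_rpow_inv_iff two_pos,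
    ← ENNReal.ofReal_inv_of_pos hr, ENNReal.ofReal_rpow_of_pos (by positivity)]
  norm_num

theorem subFocal_of_lt {r : ℝ} (hr : 0 < r) (h : ENNReal.ofReal r < focRadMinus K μ) (i : ι) :
    (hμ.curve i).SubFocal r := by
  have h1 := h.trans_le (iInf_le (focRadMinusOn K μ) i)
  unfold focRadMinusOn at h1
  rw [ofReal_lt_rpow_neg_half hr] at h1
  obtain ⟨hA, hB⟩ := max_lt_iff.1 h1
  intro s
  constructor
  · have h2 := (le_iSup (fun s => ENNReal.ofReal (|deriv (wt K μ i) s| ^ 2)) s).trans_lt hB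
    rw [ENNReal.ofReal_lt_ofReal_iff (by positivity), lt_div_iff₀ (by positivity), sq_abs] at h2
    rwa [mul_comm]
  · intro hd
    have h2 := (le_iSup₂ (f := fun s (_ : 0 < disc K μ i s) =>
      ENNReal.ofReal (focal K μ i s)) s hd).trans_lt hA
    rw [ENNReal.ofReal_lt_ofReal_iff (by positivity), lt_div_iff₀ (by positivity),
      focal_eq hμ] at h2
    rwa [mul_comm]

theorem exists_of_focRadMinus_lt {r : ℝ} (hr : 0 < r) (h : focRadMinus K μ < ENNReal.ofReal r) :
    ∃ i s, 1 < r ^ 2 * (hμ.curve i).m1 s ^ 2 ∨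
      (0 < (hμ.curve i).disc s ∧ 1 < r ^ 2 * (hμ.curve i).focal s) := by
  obtain ⟨i, hi⟩ := iInf_lt_iff.1 h
  unfold focRadMinusOn at hi
  rw [rpow_neg_half_lt_ofReal hr] at hi
  have hr2 : 0 < r ^ 2 := by positivity
  rcases lt_max_iff.1 hi with h1 | h1
  · obtain ⟨s, hs⟩ := lt_iSup_iff.1 h1
    obtain ⟨hd, hs⟩ := lt_iSup_iff.1 hs
    rw [ENNReal.ofReal_lt_ofReal_iff_of_nonneg (by positivity), div_lt_iff₀ hr2,
      focal_eq hμ] at hs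
    exact ⟨i, s, Or.inr ⟨hd, by linarith⟩⟩
  · obtain ⟨s, hs⟩ := lt_iSup_iff.1 h1
    rw [ENNReal.ofReal_lt_ofReal_iff_of_nonneg (by positivity), div_lt_iff₀ hr2, sq_abs] at hs
    exact ⟨i, s, Or.inl (by rw [mul_comm]; exact hs)⟩

/-! ### Circular arcs -/

theorem mem_arcRadii_iff {r : ℝ} : r ∈ arcRadii K μ ↔ 0 < r ∧ ENNReal.ofReal r < UR K μ ∧
    ∃ (i : ι) (s₁ s₂ k : ℝ), s₁ < s₂ ∧ (hμ.curve i).HasArc k r s₁ s₂ := by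
  constructor
  · rintro ⟨h0, h1, i, s₁, s₂, k, a, h2, ⟨hk, h3⟩, h4⟩
    exact ⟨h0, h1, i, s₁, s₂, k, h2, hk, h3, a, h4⟩
  · rintro ⟨h0, h1, i, s₁, s₂, k, h2, hk, h3, a, h4⟩
    exact ⟨h0, h1, i, s₁, s₂, k, a, h2, ⟨hk, h3⟩, h4⟩

/-- An interval of critical points at value at most `r` is an arc by `hasArc_of_crit_eq_zero`, and
its value lies in `arcRadii` because it is also below `UR`. -/
theorem noArc_of_lt {r : ℝ} (hr : 0 < r) (hU : ENNReal.ofReal r < UR K μ)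
    (hS : ∀ R ∈ arcRadii K μ, r < R) (i : ι) : (hμ.curve i).NoArc r := by
  intro p a b hab h
  by_contra hn
  rw [not_lt] at hn
  have hsf := (subFocal_of_lt hμ hr (hU.trans_le (min_le_right _ _)) i).mono
    ((hμ.curve i).ratio_nonneg p a) hn
  obtain ⟨h0, k, hk⟩ := (hμ.curve i).hasArc_of_crit_eq_zero hab h hsf
  refine absurd (hS _ ((mem_arcRadii_iff hμ).2 ⟨h0, ?_, i, a, b, k, hab, hk⟩)) (not_lt.2 hn)
  exact (ENNReal.ofReal_le_ofReal hn).trans_lt hU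

/-- The radii of arcs are visible in the pointwise compatibility conditions. -/
theorem arcRadii_eq_empty_iff (hμ : IsWeight K μ) :
    arcRadii K μ = ∅ ↔ ∀ i, interior (compatibleSet K μ i) = ∅ := by
  rw [← not_iff_not, ← Ne, ← nonempty_iff_ne_empty, not_forall]
  constructor
  · rintro ⟨r, hr⟩
    obtain ⟨h0, hU, i, s₁, s₂, k, hlt, h⟩ := (mem_arcRadii_iff hμ).1 hr
    refine ⟨i, ?_⟩
    rw [← Ne, ← nonempty_iff_ne_empty]
    have hode := h.ode h0 hlt
    have hk := h.1
    refine (nonempty_Ioo.2 hlt).mono (interior_maximal (fun s hs => ?_) isOpen_Ioo)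
    obtain ⟨e1, e2, e3, e4⟩ := hode s (Ioo_subset_Icc_self hs)
    have e1' : curv K i s = k := e1
    refine ⟨?_, ?_, ?_, ?_, r, h0, hU, e4⟩
    · rw [disc_eq hμ, WeightedCurve.disc, e1, e3]; ring
    · have : curv K i =ᶠ[𝓝 s] fun _ => k := by
        filter_upwards [Ioo_mem_nhds hs.1 hs.2] with t ht
        exact (hode t (Ioo_subset_Icc_self ht)).1
      rw [this.deriv_eq, deriv_const]
    · rwa [e1']
    · rw [e1']
      change (hμ.curve i).c3 s + k ^ 2 • (hμ.curve i).c1 s = 0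
      rw [e2]; module
  · rintro ⟨i, hi⟩
    rw [← Ne, ← nonempty_iff_ne_empty] at hi
    obtain ⟨s0, hs0⟩ := hi
    obtain ⟨ε, hε, hb⟩ := Metric.nhds_basis_closedBall.mem_iff.1 (mem_interior_iff_mem_nhds.1 hs0)
    rw [Real.closedBall_eq_Icc] at hb
    set a := s0 - ε
    set b := s0 + ε
    have hab : a < b := by simp only [a, b]; linarith
    have ha : a ∈ Icc a b := left_mem_Icc.2 hab.le
    -- A zero value of `deriv` is informative only where `curv` is differentiable, which holds
    -- because the curvature is positive.
    have hk : ∀ s ∈ Icc a b, curv K i s = curv K i a := by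
      refine eq_of_hasDerivAt_zero fun s hs => ?_
      have h1 := (hb hs).2.1
      rw [← h1]
      refine DifferentiableAt.hasDerivAt ?_
      refine DifferentiableAt.norm ℝ ((hμ.curve i).hc2 s).differentiableAt ?_
      exact norm_pos_iff.1 (hb hs).2.2.1
    have hm2 : ∀ s ∈ Icc a b, (hμ.curve i).m2 s = -(curv K i a ^ 2 / 4 * (hμ.curve i).m s) :=
      fun s hs => by
      have h1 := (hb hs).1
      rw [← hk s hs]
      rw [disc] at h1
      change iteratedDeriv 2 (wt K μ i) s = -(curv K i s ^ 2 / 4 * wt K μ i s)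
      linarith
    obtain ⟨r, hr0, hrU, hr⟩ := (hb ha).2.2.2.2
    -- The first integral of the equation for the weight: the radius found at `a` serves the whole
    -- interval, although the pointwise condition lets it vary.
    have hconst := eq_of_hasDerivAt_zero (a := a) (b := b)
      (f := fun s => (hμ.curve i).m1 s ^ 2 + curv K i a ^ 2 / 4 * (hμ.curve i).m s ^ 2)
      (fun s hs => by
        refine ((((hμ.curve i).hm1 s).pow 2).add
          ((((hμ.curve i).hm s).pow 2).const_mul _)).congr_deriv ?_
        rw [hm2 s hs]
        push_cast
        ring)
    refine ⟨r, (mem_arcRadii_iff hμ).2 ⟨hr0, hrU, i, a, b, curv K i a, hab,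
      (hμ.curve i).hasArc_of_ode hab (hb ha).2.2.1 hr0 hk ?_ hm2 ?_⟩⟩
    · intro s hs
      have h1 := (hb hs).2.2.2.1
      rw [hk s hs] at h1
      rw [neg_smul]
      exact eq_neg_of_add_eq_zero_left h1
    · intro s hs
      have h1 := hconst s hs
      have h2 := hm2 a ha
      have hr' : (hμ.curve i).m1 a ^ 2 - (hμ.curve i).m a * (hμ.curve i).m2 a = 1 / r ^ 2 := hr
      rw [hm2 s hs, ← hr', h2]
      linear_combination h1

end Setup

/-! ### Double critical pairs -/

theorem WeightedCurve.hasDerivAt_pair {V : Type*} [NormedAddCommGroup V] [InnerProductSpace ℝ V]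
    (C : WeightedCurve V) (q : V) {b : ℝ} (hb : 0 < b) (s : ℝ) :
    HasDerivAt (fun u => ‖C.c u - q‖ ^ 2 * ((C.m u + b) ^ 2)⁻¹)
      (2 * (inner ℝ (C.c s - q) (C.c1 s) * (C.m s + b) - ‖C.c s - q‖ ^ 2 * C.m1 s)
        / (C.m s + b) ^ 3) s := by
  have hM : 0 < C.m s + b := add_pos (C.m_pos s) hb
  refine ((((C.hc s).sub_const q).norm_sq).mul
    ((((C.hm s).add_const b).pow 2).inv (pow_ne_zero 2 hM.ne'))).congr_deriv ?_
  simp only [Pi.pow_apply, Pi.inv_apply]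
  field_simp
  push_cast
  ring

section Pairs

variable {n : ℕ} {ι : Type*} {K : ClosedCurves n ι} {μ : E n → ℝ} (hμ : IsWeight K μ)

/-- Vanishing of the differential splits into two partial derivatives, in the form that
`crit_eq_pair` compares with `crit` at the dividing point. -/
theorem isDoubleCritical_iff (i j : ι) (s t : ℝ) :
    IsDoubleCritical K μ i j s t ↔ K.γ i s ≠ K.γ j t ∧
      inner ℝ (K.γ i s - K.γ j t) ((hμ.curve i).c1 s) * (wt K μ i s + wt K μ j t)
        - ‖K.γ i s - K.γ j t‖ ^ 2 * (hμ.curve i).m1 s = 0 ∧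
      inner ℝ (K.γ j t - K.γ i s) ((hμ.curve j).c1 t) * (wt K μ j t + wt K μ i s)
        - ‖K.γ j t - K.γ i s‖ ^ 2 * (hμ.curve j).m1 t = 0 := by
  set f : ℝ × ℝ → ℝ := fun x =>
    ‖K.γ i x.1 - K.γ j x.2‖ ^ 2 * ((wt K μ i x.1 + wt K μ j x.2) ^ 2)⁻¹ with hf
  have hmi : 0 < wt K μ i s := hμ.pos i s
  have hmj : 0 < wt K μ j t := hμ.pos j t
  have hM : 0 < wt K μ i s + wt K μ j t := add_pos hmi hmj
  have hdiff : DifferentiableAt ℝ f (s, t) := by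
    have h1 : DifferentiableAt ℝ (fun x : ℝ × ℝ => K.γ i x.1) (s, t) :=
      DifferentiableAt.comp (s, t) (f := Prod.fst) ((hμ.curve i).hc s).differentiableAt
        differentiableAt_fst
    have h2 : DifferentiableAt ℝ (fun x : ℝ × ℝ => K.γ j x.2) (s, t) :=
      DifferentiableAt.comp (s, t) (f := Prod.snd) ((hμ.curve j).hc t).differentiableAt
        differentiableAt_snd
    have h3 : DifferentiableAt ℝ (fun x : ℝ × ℝ => wt K μ i x.1) (s, t) :=
      DifferentiableAt.comp (s, t) (f := Prod.fst) ((hμ.curve i).hm s).differentiableAt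
        differentiableAt_fst
    have h4 : DifferentiableAt ℝ (fun x : ℝ × ℝ => wt K μ j x.2) (s, t) :=
      DifferentiableAt.comp (s, t) (f := Prod.snd) ((hμ.curve j).hm t).differentiableAt
        differentiableAt_snd
    exact ((h1.sub h2).norm_sq ℝ).mul (((h3.add h4).pow 2).inv (pow_ne_zero 2 hM.ne'))
  have p1 : ∀ f', HasFDerivAt f f' (s, t) → f' (1, 0) = _ := fun f' hf' =>
    (HasFDerivAt.comp_hasDerivAt s (f := fun u => (u, t)) hf'
      ((hasDerivAt_id s).prodMk (hasDerivAt_const s t))).unique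
      ((hμ.curve i).hasDerivAt_pair (K.γ j t) hmj s)
  have p2 : ∀ f', HasFDerivAt f f' (s, t) → f' (0, 1) = _ := fun f' hf' => by
    refine (HasFDerivAt.comp_hasDerivAt t (f := fun u => (s, u)) hf'
      ((hasDerivAt_const t s).prodMk (hasDerivAt_id t))).unique ?_
    have e : f ∘ (fun u => (s, u)) = fun u => ‖K.γ j u - K.γ i s‖ ^ 2 *
        ((wt K μ j u + wt K μ i s) ^ 2)⁻¹ := by
      funext u
      simp only [hf, Function.comp]
      rw [norm_sub_rev, add_comm]
    rw [e]
    exact (hμ.curve j).hasDerivAt_pair (K.γ i s) hmi t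
  have hM' : 0 < wt K μ j t + wt K μ i s := add_pos hmj hmi
  unfold IsDoubleCritical
  refine and_congr_right fun _ => ⟨fun h => ?_, fun h => ?_⟩
  · have e1 := p1 _ h
    have e2 := p2 _ h
    simp only [zero_apply] at e1 e2
    refine ⟨?_, ?_⟩
    · rcases div_eq_zero_iff.1 e1.symm with h | h
      · exact (mul_eq_zero.1 h).resolve_left two_ne_zero
      · exact absurd h (pow_ne_zero 3 hM.ne')
    · rcases div_eq_zero_iff.1 e2.symm with h | h
      · exact (mul_eq_zero.1 h).resolve_left two_ne_zero
      · exact absurd h (pow_ne_zero 3 hM'.ne')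
  · have e1 := p1 _ hdiff.hasFDerivAt
    have e2 := p2 _ hdiff.hasFDerivAt
    have e0 : fderiv ℝ f (s, t) = 0 := by
      refine ContinuousLinearMap.ext fun x => ?_
      have : x = x.1 • ((1 : ℝ), (0 : ℝ)) + x.2 • ((0 : ℝ), (1 : ℝ)) := by
        ext <;> simp
      rw [this, map_add, map_smul, map_smul, e1, e2]
      have h1 := h.1
      have h2 := h.2
      simp only [IsWeight.curve] at h1 h2 ⊢
      rw [h1, h2]
      simp
    rw [← e0]
    exact hdiff.hasFDerivAt

end Pairs

theorem eventually_norm_add_smul_lt {V : Type*} [NormedAddCommGroup V] [InnerProductSpace ℝ V]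
    {x v : V} (h : inner ℝ x v < 0) : ∀ᶠ τ : ℝ in 𝓝[>] 0, ‖x + τ • v‖ < ‖x‖ := by
  have h1 : ∀ᶠ τ : ℝ in 𝓝 0, 2 * inner ℝ x v + τ * ‖v‖ ^ 2 < 0 := by
    have hc : Continuous fun τ : ℝ => 2 * inner ℝ x v + τ * ‖v‖ ^ 2 := by fun_prop
    exact hc.continuousAt.eventually (gt_mem_nhds (by simp only [zero_mul, add_zero]; linarith))
  filter_upwards [h1.filter_mono nhdsWithin_le_nhds, self_mem_nhdsWithin] with τ hτ hτ0
  have hτ0 : 0 < τ := hτ0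
  refine lt_of_pow_lt_pow_left₀ 2 (norm_nonneg _) ?_
  rw [norm_add_sq_real, inner_smul_right, norm_smul, Real.norm_of_nonneg hτ0.le]
  nlinarith

/-- The point dividing the segment from `c s` to `q` in the ratio of the weights. -/
theorem WeightedCurve.crit_eq_pair {V : Type*} [NormedAddCommGroup V] [InnerProductSpace ℝ V]
    (C : WeightedCurve V) {p q : V} {s M : ℝ} (hM : M ≠ 0)
    (h : M • (p - C.c s) = -C.m s • (C.c s - q)) :
    C.crit p s = (C.m s / M) ^ 2 *
      (inner ℝ (C.c s - q) (C.c1 s) * M - ‖C.c s - q‖ ^ 2 * C.m1 s) := by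
  have hm := C.m_pos s
  have e : p - C.c s = (-(C.m s / M)) • (C.c s - q) := by
    apply smul_right_injective V hM
    simp only
    rw [h, smul_smul]
    congr 1
    field_simp
  unfold crit
  rw [e, inner_smul_left, norm_smul, Real.norm_eq_abs, mul_pow, sq_abs]
  simp only [conj_trivial]
  field_simp

/-! ### Collisions of critical points. -/

section Injectivity

variable {n : ℕ} {ι : Type*} {K : ClosedCurves n ι} {μ : E n → ℝ} (hμ : IsWeight K μ)

/-- Two different points of the curves are critical for `p`, with weighted distance at most `r`. -/
structure Collision (r : ℝ) (i j : ι) (s t : ℝ) (p : E n) : Prop where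
  crit_left : (hμ.curve i).crit p s = 0
  crit_right : (hμ.curve j).crit p t = 0
  le_left : (hμ.curve i).ratio p s ≤ r
  le_right : (hμ.curve j).ratio p t ≤ r
  ne : K.γ i s ≠ K.γ j t

/-- The only condition that is not closed is that the feet differ. By `exists_isolated`, two feet
cannot merge in a limit. -/
theorem isCompact_collision {r r1 : ℝ} (hr : r < r1) (hS : ∀ i, (hμ.curve i).SubFocal r1)
    (hA : ∀ i, (hμ.curve i).NoArc r) (i j : ι) :
    IsCompact {z : ℝ × ℝ × E n | (z.1 ∈ Icc 0 (K.L i) ∧ z.2.1 ∈ Icc 0 (K.L j)) ∧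
      Collision hμ r i j z.1 z.2.1 z.2.2} := by
  have hci : Continuous fun z : ℝ × ℝ × E n => (hμ.curve i).crit z.2.2 z.1 :=
    (hμ.curve i).cont_crit.comp (f := fun z : ℝ × ℝ × E n => (z.2.2, z.1)) (by fun_prop)
  have hcj : Continuous fun z : ℝ × ℝ × E n => (hμ.curve j).crit z.2.2 z.2.1 :=
    (hμ.curve j).cont_crit.comp (f := fun z : ℝ × ℝ × E n => (z.2.2, z.2.1)) (by fun_prop)
  have hri : Continuous fun z : ℝ × ℝ × E n => (hμ.curve i).ratio z.2.2 z.1 :=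
    (hμ.curve i).cont_ratio.comp (f := fun z : ℝ × ℝ × E n => (z.2.2, z.1)) (by fun_prop)
  have hrj : Continuous fun z : ℝ × ℝ × E n => (hμ.curve j).ratio z.2.2 z.2.1 :=
    (hμ.curve j).cont_ratio.comp (f := fun z : ℝ × ℝ × E n => (z.2.2, z.2.1)) (by fun_prop)
  set A : Set (ℝ × ℝ × E n) := {z | (z.1 ∈ Icc 0 (K.L i) ∧ z.2.1 ∈ Icc 0 (K.L j)) ∧
    (hμ.curve i).crit z.2.2 z.1 = 0 ∧ (hμ.curve j).crit z.2.2 z.2.1 = 0 ∧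
    (hμ.curve i).ratio z.2.2 z.1 ≤ r ∧ (hμ.curve j).ratio z.2.2 z.2.1 ≤ r} with hAdef
  have hAc : IsClosed A := by
    refine ((isClosed_Icc.preimage continuous_fst).inter
      (isClosed_Icc.preimage (continuous_fst.comp continuous_snd))).inter
      ((isClosed_eq hci continuous_const).inter ((isClosed_eq hcj continuous_const).inter
        ((isClosed_le hri continuous_const).inter (isClosed_le hrj continuous_const))))
  obtain ⟨M, hM⟩ := (isCompact_Icc (a := (0 : ℝ)) (b := K.L i)).exists_bound_of_continuousOn
    (f := fun s => ‖K.γ i s‖ + r * (hμ.curve i).m s)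
    (((hμ.curve i).cont_c.norm.add ((hμ.curve i).cont_m.const_mul r)).continuousOn)
  have hAk : IsCompact A := by
    refine ((isCompact_Icc (a := 0) (b := K.L i)).prod ((isCompact_Icc (a := 0) (b := K.L j)).prod
      (isCompact_closedBall (0 : E n) M))).of_isClosed_subset hAc ?_
    rintro ⟨s, t, p⟩ ⟨⟨hs, ht⟩, -, -, h3, -⟩
    refine ⟨hs, ht, mem_closedBall_zero_iff.2 ?_⟩
    have h1 := hM s hs
    have h2 := (hμ.curve i).norm_eq_ratio_mul p s
    have h4 : (hμ.curve i).ratio p s * (hμ.curve i).m s ≤ r * (hμ.curve i).m s :=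
      mul_le_mul_of_nonneg_right h3 ((hμ.curve i).m_pos s).le
    have h5 : ‖p‖ ≤ ‖p - (hμ.curve i).c s‖ + ‖(hμ.curve i).c s‖ := by
      simpa using norm_add_le (p - (hμ.curve i).c s) ((hμ.curve i).c s)
    have h6 := (le_abs_self _).trans h1
    have h7 : ‖(hμ.curve i).c s‖ = ‖K.γ i s‖ := rfl
    simp only at h6 ⊢
    linarith
  refine hAk.of_isClosed_subset ?_ (fun z hz => ⟨hz.1, hz.2.1, hz.2.2, hz.2.3, hz.2.4⟩)
  rw [← isOpen_compl_iff, isOpen_iff_eventually]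
  rintro ⟨s, t, p⟩ hz
  by_cases hzA : (s, t, p) ∈ A
  · have hne : K.γ i s = K.γ j t := by
      by_contra hne
      exact hz ⟨hzA.1, hzA.2.1, hzA.2.2.1, hzA.2.2.2.1, hzA.2.2.2.2, hne⟩
    -- At a coincident pair the parameters differ by whole periods; after shifting the second one
    -- back, both are critical in one small interval and hence equal.
    obtain ⟨rfl, k, rfl⟩ := eq_of_gamma_eq hne
    obtain ⟨ε, hε, -, hev⟩ := (hμ.curve i).exists_isolated hr (hS i) (hA i) hzA.2.1 hzA.2.2.2.1
    have e1 : ∀ᶠ z : ℝ × ℝ × E n in 𝓝 (s, s + k * K.L i, p), z.1 ∈ Icc (s - ε) (s + ε) :=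
      continuousAt_fst.eventually (Icc_mem_nhds (by linarith) (by linarith))
    have e2 : ∀ᶠ z : ℝ × ℝ × E n in 𝓝 (s, s + k * K.L i, p),
        z.2.1 - k * K.L i ∈ Icc (s - ε) (s + ε) := by
      have hc : Continuous fun z : ℝ × ℝ × E n => z.2.1 - k * K.L i := by fun_prop
      exact hc.continuousAt.eventually (Icc_mem_nhds (by simpa using hε) (by simpa using hε))
    have e3 := (continuous_snd.comp continuous_snd).continuousAt (x := (s, s + k * K.L i, p))
      |>.eventually hev
    filter_upwards [e1, e2, e3] with z h1 h2 h3 hzc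
    have hC := hzc.2
    have hp1 := (periodic_crit hμ i z.2.2).int_mul k (z.2.1 - k * K.L i)
    have hp2 := (periodic_ratio hμ i z.2.2).int_mul k (z.2.1 - k * K.L i)
    rw [sub_add_cancel] at hp1 hp2
    have := h3 _ h1 _ h2 hC.1 hC.3 (hp1.symm.trans hC.2) (hp2.symm.trans_le hC.4)
    refine hC.ne ?_
    rw [this, (K.periodic i).sub_int_mul_eq]
  · filter_upwards [hAc.isOpen_compl.mem_nhds hzA] with z hz' hzc
    exact hz' ⟨hzc.1, hzc.2.1, hzc.2.2, hzc.2.3, hzc.2.4⟩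

theorem Collision.exists_min [Finite ι] {r r1 : ℝ} (hr : r < r1)
    (hS : ∀ i, (hμ.curve i).SubFocal r1) (hA : ∀ i, (hμ.curve i).NoArc r)
    {i0 j0 : ι} {s0 t0 : ℝ} {p0 : E n} (h0 : Collision hμ r i0 j0 s0 t0 p0) :
    ∃ i j s t p, Collision hμ r i j s t p ∧ ∀ i' j' s' t' p', Collision hμ r i' j' s' t' p' →
      max ((hμ.curve i).ratio p s) ((hμ.curve j).ratio p t)
        ≤ max ((hμ.curve i').ratio p' s') ((hμ.curve j').ratio p' t') := by
  set Z : ι × ι → Set (ℝ × ℝ × E n) := fun x =>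
    {z | (z.1 ∈ Icc 0 (K.L x.1) ∧ z.2.1 ∈ Icc 0 (K.L x.2)) ∧
      Collision hμ r x.1 x.2 z.1 z.2.1 z.2.2} with hZ
  set f : ι × ι → ℝ × ℝ × E n → ℝ := fun x z =>
    max ((hμ.curve x.1).ratio z.2.2 z.1) ((hμ.curve x.2).ratio z.2.2 z.2.1) with hf
  have hmove : ∀ i j s t p, Collision hμ r i j s t p → ∃ z ∈ Z (i, j),
      f (i, j) z = max ((hμ.curve i).ratio p s) ((hμ.curve j).ratio p t) := by
    intro i j s t p h
    obtain ⟨s', hs', es, hs⟩ := exists_mem_Icc hμ i s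
    obtain ⟨t', ht', et, ht⟩ := exists_mem_Icc hμ j t
    refine ⟨(s', t', p), ⟨⟨hs', ht'⟩, ?_⟩, ?_⟩
    · exact ⟨(hs p).2.trans h.1, (ht p).2.trans h.2, (hs p).1.trans_le h.3, (ht p).1.trans_le h.4,
        by simpa only [es, et] using h.5⟩
    · simp only [hf, (hs p).1, (ht p).1]
  have hmin : ∀ x, ∃ z, (Z x).Nonempty → z ∈ Z x ∧ ∀ z' ∈ Z x, f x z ≤ f x z' := by
    intro x
    by_cases hx : (Z x).Nonempty
    · have hc : Continuous (f x) :=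
        Continuous.max ((hμ.curve x.1).cont_ratio.comp
            (f := fun z : ℝ × ℝ × E n => (z.2.2, z.1)) (by fun_prop))
          ((hμ.curve x.2).cont_ratio.comp
            (f := fun z : ℝ × ℝ × E n => (z.2.2, z.2.1)) (by fun_prop))
      obtain ⟨z, hz, hzm⟩ := (isCompact_collision hμ hr hS hA x.1 x.2).exists_isMinOn hx
        hc.continuousOn
      exact ⟨z, fun _ => ⟨hz, fun z' hz' => hzm hz'⟩⟩
    · exact ⟨(0, 0, 0), fun h => absurd h hx⟩
  choose z hz using hmin
  have hne : {x | (Z x).Nonempty}.Nonempty := by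
    obtain ⟨w, hw, -⟩ := hmove _ _ _ _ _ h0
    exact ⟨(i0, j0), w, hw⟩
  obtain ⟨x, hx, hxm⟩ := Set.exists_min_image {x | (Z x).Nonempty} (fun x => f x (z x))
    (Set.toFinite _) hne
  refine ⟨x.1, x.2, (z x).1, (z x).2.1, (z x).2.2, (hz x hx).1.2, fun i' j' s' t' p' h => ?_⟩
  obtain ⟨w, hw, hwe⟩ := hmove _ _ _ _ _ h
  rw [← hwe]
  exact (hxm (i', j') ⟨w, hw⟩).trans ((hz (i', j') ⟨w, hw⟩).2 w hw)

/-- Critical points persist under small changes of `p`, with no larger weighted distance than the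
original parameter has. -/
theorem eventually_exists_crit_near {r r1 : ℝ} (hr : r < r1)
    (hS : ∀ i, (hμ.curve i).SubFocal r1) (hA : ∀ i, (hμ.curve i).NoArc r) {i : ι} {s : ℝ} {p : E n}
    (h : (hμ.curve i).crit p s = 0) (hle : (hμ.curve i).ratio p s ≤ r) {U : Set ℝ} (hU : U ∈ 𝓝 s) :
    ∀ᶠ p' in 𝓝 p, ∃ s' ∈ U, (hμ.curve i).crit p' s' = 0 ∧
      (hμ.curve i).ratio p' s' ≤ (hμ.curve i).ratio p' s := by
  obtain ⟨ε, hε, hmin, -⟩ := (hμ.curve i).exists_isolated hr (hS i) (hA i) h hle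
  obtain ⟨δ, hδ, hδU⟩ := Metric.nhds_basis_closedBall.mem_iff.1 hU
  rw [Real.closedBall_eq_Icc] at hδU
  have hη : 0 < min ε δ := lt_min hε hδ
  have h1 := min_le_left ε δ
  have h2 := min_le_right ε δ
  filter_upwards [(hμ.curve i).eventually_exists_crit (α := s - min ε δ) (β := s + min ε δ)
    ⟨by linarith, by linarith⟩ (hmin _ ⟨by linarith, by linarith⟩ (by linarith))
    (hmin _ ⟨by linarith, by linarith⟩ (by linarith))] with p' ⟨s', hs', h3⟩
  exact ⟨s', hδU ⟨by linarith [hs'.1], by linarith [hs'.2]⟩, h3⟩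

theorem eventually_ratio_lt {i : ι} {s R : ℝ} {p v : E n}
    (h : (hμ.curve i).ratio p s < R ∨
      ((hμ.curve i).ratio p s ≤ R ∧ inner ℝ (p - K.γ i s) v < 0)) :
    ∀ᶠ τ : ℝ in 𝓝[>] 0, (hμ.curve i).ratio (p + τ • v) s < R := by
  rcases h with h | ⟨h, hv⟩
  · have hc : Continuous fun τ : ℝ => (hμ.curve i).ratio (p + τ • v) s :=
      (hμ.curve i).cont_ratio.comp (f := fun τ : ℝ => (p + τ • v, s)) (by fun_prop)
    exact (hc.continuousAt.eventually (gt_mem_nhds (by simpa using h))).filter_mono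
      nhdsWithin_le_nhds
  · filter_upwards [eventually_norm_add_smul_lt hv] with τ hτ
    refine lt_of_lt_of_le ?_ h
    unfold WeightedCurve.ratio
    have := (hμ.curve i).m_pos s
    gcongr
    rw [add_sub_right_comm]
    exact hτ

/-- At a collision of least radius, no direction decreases both weighted distances. -/
theorem Collision.not_descent [Finite ι] {r r1 : ℝ} (hr : r < r1)
    (hS : ∀ i, (hμ.curve i).SubFocal r1) (hA : ∀ i, (hμ.curve i).NoArc r)
    {i j : ι} {s t : ℝ} {p : E n} (h : Collision hμ r i j s t p)
    (hmin : ∀ i' j' s' t' p', Collision hμ r i' j' s' t' p' →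
      max ((hμ.curve i).ratio p s) ((hμ.curve j).ratio p t)
        ≤ max ((hμ.curve i').ratio p' s') ((hμ.curve j').ratio p' t'))
    {R : ℝ} (hR : R = max ((hμ.curve i).ratio p s) ((hμ.curve j).ratio p t)) {v : E n}
    (hi : (hμ.curve i).ratio p s < R ∨
      ((hμ.curve i).ratio p s ≤ R ∧ inner ℝ (p - K.γ i s) v < 0))
    (hj : (hμ.curve j).ratio p t < R ∨
      ((hμ.curve j).ratio p t ≤ R ∧ inner ℝ (p - K.γ j t) v < 0)) : False := by
  have hRr : R ≤ r := hR ▸ max_le h.3 h.4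
  have hne : ∀ᶠ x : ℝ × ℝ in 𝓝 s ×ˢ 𝓝 t, K.γ i x.1 ≠ K.γ j x.2 := by
    rw [← nhds_prod_eq]
    have hc : Continuous fun x : ℝ × ℝ => K.γ i x.1 - K.γ j x.2 :=
      ((hμ.curve i).cont_c.comp continuous_fst).sub ((hμ.curve j).cont_c.comp continuous_snd)
    filter_upwards [(hc.continuousAt (x := (s, t))).eventually_ne (sub_ne_zero.2 h.ne)] with x hx
    exact sub_ne_zero.1 hx
  -- Neighbourhoods of `s` and `t` in which moved critical points remain feet of a genuine
  -- collision.
  obtain ⟨P, hP, Q, hQ, hPQ⟩ := eventually_prod_iff.1 hne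
  have e1 := eventually_exists_crit_near hμ hr hS hA h.1 h.3 hP
  have e2 := eventually_exists_crit_near hμ hr hS hA h.2 h.4 hQ
  have hlim : Tendsto (fun τ : ℝ => p + τ • v) (𝓝[>] 0) (𝓝 p) := by
    have hc : Continuous fun τ : ℝ => p + τ • v := by fun_prop
    have := (hc.tendsto 0).mono_left (nhdsWithin_le_nhds (s := Ioi 0))
    simpa using this
  obtain ⟨τ, ⟨s', hs', cs, rs⟩, ⟨t', ht', ct, rt⟩, h3, h4⟩ :=
    ((hlim.eventually e1).and ((hlim.eventually e2).and
      ((eventually_ratio_lt hμ hi).and (eventually_ratio_lt hμ hj)))).exists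
  have := hmin i j s' t' (p + τ • v) ⟨cs, ct, (rs.trans h3.le).trans hRr,
    (rt.trans h4.le).trans hRr, hPQ hs' ht'⟩
  rw [← hR] at this
  exact absurd this (not_le.2 (max_lt (rs.trans_lt h3) (rt.trans_lt h4)))

/-- Below the focal radii, and if there are no arcs, a collision forces a double critical pair. -/
theorem Collision.exists_isDoubleCritical [Finite ι] {r r1 : ℝ} (hr : r < r1)
    (hS : ∀ i, (hμ.curve i).SubFocal r1) (hA : ∀ i, (hμ.curve i).NoArc r)
    {i0 j0 : ι} {s0 t0 : ℝ} {p0 : E n} (h0 : Collision hμ r i0 j0 s0 t0 p0) :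
    ∃ i j s t, IsDoubleCritical K μ i j s t ∧
      ‖K.γ i s - K.γ j t‖ / (wt K μ i s + wt K μ j t) ≤ r := by
  obtain ⟨i, j, s, t, p, h, hmin⟩ := h0.exists_min hμ hr hS hA
  set R := max ((hμ.curve i).ratio p s) ((hμ.curve j).ratio p t) with hR
  have hnd := fun v hi hj => h.not_descent hμ hr hS hA hmin hR (v := v) hi hj
  have hi_le : (hμ.curve i).ratio p s ≤ R := le_max_left _ _
  have hj_le : (hμ.curve j).ratio p t ≤ R := le_max_right _ _
  have hmi := (hμ.curve i).m_pos s
  have hmj := (hμ.curve j).m_pos t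
  have hni : ‖p - K.γ i s‖ = _ := (hμ.curve i).norm_eq_ratio_mul p s
  have hnj : ‖p - K.γ j t‖ = _ := (hμ.curve j).norm_eq_ratio_mul p t
  have hRpos : 0 < R := by
    by_contra hn
    have h1 : (hμ.curve i).ratio p s = 0 :=
      le_antisymm (hi_le.trans (not_lt.1 hn)) ((hμ.curve i).ratio_nonneg p s)
    have h2 : (hμ.curve j).ratio p t = 0 :=
      le_antisymm (hj_le.trans (not_lt.1 hn)) ((hμ.curve j).ratio_nonneg p t)
    rw [h1, zero_mul, norm_eq_zero, sub_eq_zero] at hni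
    rw [h2, zero_mul, norm_eq_zero, sub_eq_zero] at hnj
    exact h.ne (hni.symm.trans hnj)
  have hneg : ∀ x : E n, 0 < ‖x‖ → inner ℝ x (-x) < 0 := fun x hx => by
    rw [inner_neg_right, real_inner_self_eq_norm_sq]
    nlinarith
  -- If one value were below the maximum, moving `p` towards the other foot would decrease the
  -- larger value and keep the smaller below `R`.
  have hiR : (hμ.curve i).ratio p s = R := by
    by_contra hne
    have hlt := lt_of_le_of_ne hi_le hne
    have hjR : (hμ.curve j).ratio p t = R := by
      rcases max_choice ((hμ.curve i).ratio p s) ((hμ.curve j).ratio p t) with e | e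
      · exact absurd (hR.trans e) (fun e' => hne e'.symm)
      · exact (hR.trans e).symm
    exact hnd (-(p - K.γ j t)) (Or.inl hlt)
      (Or.inr ⟨hj_le, hneg _ (by rw [hnj, hjR]; positivity)⟩)
  have hjR : (hμ.curve j).ratio p t = R := by
    by_contra hne
    exact hnd (-(p - K.γ i s)) (Or.inr ⟨hi_le, hneg _ (by rw [hni, hiR]; positivity)⟩)
      (Or.inl (lt_of_le_of_ne hj_le hne))
  rw [hiR] at hni
  rw [hjR] at hnj
  have hxpos : 0 < ‖p - K.γ i s‖ := by rw [hni]; positivity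
  have hypos : 0 < ‖p - K.γ j t‖ := by rw [hnj]; positivity
  -- Unless the feet lie in opposite directions from `p`, moving along the bisector of these
  -- directions decreases both distances.
  have hopp : inner ℝ (p - K.γ i s) (-(p - K.γ j t)) = ‖p - K.γ i s‖ * ‖-(p - K.γ j t)‖ := by
    by_contra hne
    have hlt : -(inner ℝ (p - K.γ i s) (p - K.γ j t)) < ‖p - K.γ i s‖ * ‖p - K.γ j t‖ := by
      have := lt_of_le_of_ne (real_inner_le_norm _ _) hne
      rwa [inner_neg_right, norm_neg] at this
    refine hnd (-(‖p - K.γ j t‖ • (p - K.γ i s) + ‖p - K.γ i s‖ • (p - K.γ j t)))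
      (Or.inr ⟨hi_le, ?_⟩) (Or.inr ⟨hj_le, ?_⟩)
    · rw [inner_neg_right, inner_add_right, inner_smul_right, inner_smul_right,
        real_inner_self_eq_norm_sq]
      nlinarith
    · rw [inner_neg_right, inner_add_right, inner_smul_right, inner_smul_right,
        real_inner_self_eq_norm_sq, real_inner_comm]
      nlinarith
  have hpar := inner_eq_norm_mul_iff_real.1 hopp
  rw [norm_neg, hni, hnj] at hpar
  -- So `p` divides the segment between the feet in the ratio of the weights.
  have hpar' : (hμ.curve j).m t • (p - K.γ i s) = -((hμ.curve i).m s • (p - K.γ j t)) := by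
    apply smul_right_injective (E n) hRpos.ne'
    simp only
    rw [smul_smul, hpar, smul_neg, smul_neg, smul_smul]
  have hM : 0 < (hμ.curve i).m s + (hμ.curve j).m t := add_pos hmi hmj
  have e1 : ((hμ.curve i).m s + (hμ.curve j).m t) • (p - K.γ i s)
      = -(hμ.curve i).m s • (K.γ i s - K.γ j t) := by
    rw [add_smul, hpar']; module
  have e2 : ((hμ.curve j).m t + (hμ.curve i).m s) • (p - K.γ j t)
      = -(hμ.curve j).m t • (K.γ j t - K.γ i s) := by
    have : (hμ.curve i).m s • (p - K.γ j t) = -((hμ.curve j).m t • (p - K.γ i s)) := by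
      rw [hpar', neg_neg]
    rw [add_smul, this]; module
  have c1 := (hμ.curve i).crit_eq_pair hM.ne' e1
  have c2 := (hμ.curve j).crit_eq_pair (by rw [add_comm]; exact hM.ne') e2
  rw [h.1] at c1
  rw [h.2] at c2
  refine ⟨i, j, s, t, (isDoubleCritical_iff hμ i j s t).2 ⟨h.ne, ?_, ?_⟩, ?_⟩
  · exact (mul_eq_zero.1 c1.symm).resolve_left (by positivity)
  · refine (mul_eq_zero.1 c2.symm).resolve_left ?_
    rw [add_comm] at hM
    positivity
  · have hn := congrArg norm e1
    rw [norm_smul, norm_smul, hni, norm_neg, Real.norm_of_nonneg hM.le,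
      Real.norm_of_nonneg hmi.le] at hn
    have : ‖K.γ i s - K.γ j t‖ = R * (wt K μ i s + wt K μ j t) := by
      apply mul_left_cancel₀ hmi.ne'
      rw [← hn]
      change _ = (hμ.curve i).m s * (R * ((hμ.curve i).m s + (hμ.curve j).m t))
      ring
    rw [this, mul_div_assoc, div_self (show wt K μ i s + wt K μ j t ≠ 0 from hM.ne'), mul_one]
    exact max_le h.3 h.4

end Injectivity

/-! ### Continuity, compactness and the lower bounds for `TIR` and `AIR`. -/

section LowerBound

variable {n : ℕ} {ι : Type*} {K : ClosedCurves n ι} {μ : E n → ℝ}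

theorem range_gamma (i : ι) : range (K.γ i) = K.γ i '' Icc 0 (K.L i) := by
  refine subset_antisymm ?_ (image_subset_range _ _)
  rintro _ ⟨s, rfl⟩
  obtain ⟨t, ht, e⟩ := (K.periodic i).exists_mem_Ico₀ (K.length_pos i) s
  exact ⟨t, Ico_subset_Icc_self ht, e.symm⟩

theorem continuous_gamma (i : ι) : Continuous (K.γ i) := (K.contDiff i).continuous

theorem isClosed_range_gamma (i : ι) : IsClosed (range (K.γ i)) := by
  rw [range_gamma]
  exact (isCompact_Icc.image (continuous_gamma i)).isClosed

/-- A function on the curves is continuous if it is so in terms of the parameters. -/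
theorem continuousOn_of_comp_gamma [Finite ι] {Y : Type*} [TopologicalSpace Y] {f : E n → Y}
    (h : ∀ i, Continuous fun s => f (K.γ i s)) : ContinuousOn f (⋃ i, range (K.γ i)) := by
  rw [continuousOn_iff_isClosed]
  intro t ht
  refine ⟨⋃ i, K.γ i '' ((fun s => f (K.γ i s)) ⁻¹' t ∩ Icc 0 (K.L i)), ?_, ?_⟩
  · refine isClosed_iUnion_of_finite fun i => ?_
    exact ((isCompact_Icc.inter_left (ht.preimage (h i))).image (continuous_gamma i)).isClosed
  · ext q
    refine and_congr_left fun hq => ?_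
    obtain ⟨i, hi⟩ := mem_iUnion.1 hq
    rw [range_gamma] at hi
    obtain ⟨s, hs, rfl⟩ := hi
    constructor
    · intro hq
      exact mem_iUnion.2 ⟨i, s, ⟨hq, hs⟩, rfl⟩
    · intro hq
      obtain ⟨j, u, ⟨hu, -⟩, e⟩ := mem_iUnion.1 hq
      rw [← e]
      exact hu

theorem mapsTo_fst_NK : MapsTo Prod.fst (NK K) (⋃ i, range (K.γ i)) := by
  rintro x ⟨i, s, h, -⟩
  exact mem_iUnion.2 ⟨i, s, h⟩

theorem continuousOn_weight [Finite ι] (hμ : IsWeight K μ) :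
    ContinuousOn (fun x : E n × E n => μ x.1) (NK K) :=
  (continuousOn_of_comp_gamma fun i => (hμ.contDiff i).continuous).comp continuousOn_fst
    mapsTo_fst_NK

theorem continuousOn_grad [Finite ι] (hμ : IsWeight K μ) :
    ContinuousOn (fun x : E n × E n => grad K μ x.1) (NK K) := by
  refine ContinuousOn.comp (g := grad K μ) (continuousOn_of_comp_gamma fun i => ?_)
    continuousOn_fst mapsTo_fst_NK
  simp only [grad_apply]
  exact (hμ.curve i).cont_m1.smul (hμ.curve i).cont_c1

theorem continuousOn_expMu [Finite ι] (hμ : IsWeight K μ) : ContinuousOn (expMu K μ) (NK K) := by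
  have h1 := continuousOn_weight hμ
  have h2 := continuousOn_grad hμ
  have h3 : ContinuousOn (fun x : E n × E n => √(1 - ‖grad K μ x.1‖ ^ 2 * ‖x.2‖ ^ 2)) (NK K) :=
    Real.continuous_sqrt.comp_continuousOn (by fun_prop)
  exact (continuousOn_fst.sub ((h1.mul (continuousOn_snd.norm.pow 2)).smul h2)).add
    ((h1.mul h3).smul continuousOn_snd)

theorem isCompact_closedD [Finite ι] (r : ℝ) : IsCompact {x ∈ NK K | ‖x.2‖ ≤ r} := by
  have : {x ∈ NK K | ‖x.2‖ ≤ r} = ⋃ i, (fun z : ℝ × E n => (K.γ i z.1, z.2)) ''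
      (Icc 0 (K.L i) ×ˢ Metric.closedBall 0 r ∩ {z | inner ℝ (deriv (K.γ i) z.1) z.2 = 0}) := by
    ext x
    simp only [mem_iUnion]
    constructor
    · rintro ⟨⟨i, s, h1, h2⟩, hr⟩
      obtain ⟨k, hk, -⟩ := existsUnique_add_zsmul_mem_Ico (K.length_pos i) s 0
      rw [zero_add] at hk
      refine ⟨i, (s + k • K.L i, x.2), ⟨⟨Ico_subset_Icc_self hk, ?_⟩, ?_⟩, ?_⟩
      · exact mem_closedBall_zero_iff.2 hr
      · have := (periodic_deriv (K.periodic i)).zsmul k s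
        change inner ℝ (deriv (K.γ i) (s + k • K.L i)) x.2 = 0
        rw [this, h2]
      · refine Prod.ext ?_ rfl
        exact ((K.periodic i).zsmul k s).trans h1
    · rintro ⟨i, z, ⟨⟨-, hz⟩, h⟩, rfl⟩
      exact ⟨⟨i, z.1, rfl, h⟩, mem_closedBall_zero_iff.1 hz⟩
  rw [this]
  refine isCompact_iUnion fun i => IsCompact.image ?_ ?_
  · refine (isCompact_Icc.prod (isCompact_closedBall _ _)).inter_right
      (isClosed_eq ?_ continuous_const)
    have : Continuous (deriv (K.γ i)) := (K.contDiff i).continuous_deriv (by norm_num)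
    fun_prop
  · have := continuous_gamma (K := K) i
    fun_prop

theorem admissible_of_subFocal (hμ : IsWeight K μ) {r : ℝ}
    (h : ∀ i, (hμ.curve i).SubFocal r) : Admissible hμ r :=
  fun i s => (h i s).1.le

/-- Below `UR` and below all arc radii, the exponential map is an open embedding. -/
theorem isEmbedding_expMu [Finite ι] (hμ : IsWeight K μ) {r : ℝ} (hr : 0 < r)
    (hU : ENNReal.ofReal r < UR K μ) (hS : ∀ R ∈ arcRadii K μ, r < R) :
    D K r ⊆ W K μ ∧ IsEmbedding ((D K r).domRestrict (expMu K μ)) ∧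
      IsOpen (expMu K μ '' D K r) := by
  obtain ⟨c, hc1, hc2⟩ := exists_between hU
  have hctop : c ≠ ⊤ := (hc2.trans_le le_top).ne
  have hcr : ENNReal.ofReal c.toReal = c := ENNReal.ofReal_toReal hctop
  set r1 := c.toReal
  have hrr : r < r1 := by
    rw [← hcr] at hc1
    exact (ENNReal.ofReal_lt_ofReal_iff_of_nonneg hr.le).1 hc1
  rw [← hcr] at hc2
  have hSF : ∀ i, (hμ.curve i).SubFocal r1 := subFocal_of_lt hμ (hr.trans hrr)
    (hc2.trans_le (min_le_right _ _))
  have hNA : ∀ i, (hμ.curve i).NoArc r := noArc_of_lt hμ hr hU hS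
  have hadm1 := admissible_of_subFocal hμ hSF
  have hadm : Admissible hμ r := admissible_of_subFocal hμ fun i => (hSF i).mono hr.le hrr.le
  -- Working on the compact closed disc bundle turns continuity and injectivity into an embedding,
  -- which then restricts to `D K r`.
  set B : Set (E n × E n) := {x ∈ NK K | ‖x.2‖ ≤ r}
  have hBD : B ⊆ D K r1 := fun x hx => ⟨hx.1, lt_of_le_of_lt hx.2 hrr⟩
  have hinj : Function.Injective (B.domRestrict (expMu K μ)) := by
    rintro ⟨x, hx⟩ ⟨y, hy⟩ hxy
    have hxy : expMu K μ x = expMu K μ y := hxy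
    refine Subtype.ext (expMu_injective hμ hadm1 (hBD hx) (hBD hy) ?_ hxy)
    by_contra hne
    obtain ⟨i, s, h1, -⟩ := id hx.1
    obtain ⟨j, t, h2, -⟩ := id hy.1
    obtain ⟨cx, rx⟩ := crit_expMu hμ (hadm1.subset_W hμ (hBD hx)) h1
    obtain ⟨cy, ry⟩ := crit_expMu hμ (hadm1.subset_W hμ (hBD hy)) h2
    rw [← hxy] at cy ry
    have hcol : Collision hμ r i j s t (expMu K μ x) :=
      ⟨cx, cy, rx.trans_le hx.2, ry.trans_le hy.2, by rwa [h1, h2]⟩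
    obtain ⟨i', j', s', t', hdc, hle⟩ := hcol.exists_isDoubleCritical hμ hrr hSF hNA
    have h3 : halfDCSD K μ ≤ ENNReal.ofReal r :=
      (iInf_le_of_le i' (iInf_le_of_le j' (iInf_le_of_le s' (iInf_le_of_le t'
        (iInf_le _ hdc))))).trans (ENNReal.ofReal_le_ofReal hle)
    exact absurd (hU.trans_le (min_le_left _ _)) (not_lt.2 h3)
  have hDB : D K r ⊆ B := fun x hx => ⟨hx.1, le_of_lt hx.2⟩
  refine ⟨hadm.subset_W hμ, ?_, ?_⟩
  · have : CompactSpace B := isCompact_iff_compactSpace.1 (isCompact_closedD r)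
    have hcont : Continuous (B.domRestrict (expMu K μ)) :=
      ((continuousOn_expMu hμ).mono fun x hx => hx.1).domRestrict
    exact (hcont.isClosedEmbedding hinj).isEmbedding.comp (IsEmbedding.inclusion hDB)
  · rw [isOpen_iff_mem_nhds]
    rintro _ ⟨x, hx, rfl⟩
    obtain ⟨i, s, h1, -⟩ := id hx.1
    obtain ⟨cx, rx⟩ := crit_expMu hμ (hadm.subset_W hμ hx) h1
    have hxr : ‖x.2‖ < r := hx.2
    -- Openness of the image: the foot of `expMu K μ x` persists for nearby `p` with value still
    -- below `r`, and so yields a preimage.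
    have hev : ∀ᶠ p in 𝓝 (expMu K μ x), (hμ.curve i).ratio p s < r :=
      (isOpen_lt ((hμ.curve i).cont_ratio_left s) continuous_const).mem_nhds
        (show _ < r by rw [rx]; exact hxr)
    filter_upwards [eventually_exists_crit_near hμ hrr hSF hNA cx (rx.trans_le hxr.le) univ_mem,
      hev] with p ⟨s', _, h3, h4⟩ h5
    obtain ⟨y, hy, -, -, e⟩ := exists_expMu_eq hμ hadm h3 (h4.trans_lt h5)
    exact ⟨y, hy, e⟩

theorem le_TIR_of_lt [Finite ι] (hμ : IsWeight K μ) {c : ℝ≥0∞} (hU : c < UR K μ)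
    (hS : ∀ R ∈ arcRadii K μ, c < ENNReal.ofReal R) : c ≤ TIR K μ ∧ c ≤ AIR K μ := by
  rcases eq_or_ne c 0 with rfl | h0
  · exact ⟨zero_le, zero_le⟩
  have hctop : c ≠ ⊤ := (hU.trans_le le_top).ne
  have hcr : ENNReal.ofReal c.toReal = c := ENNReal.ofReal_toReal hctop
  have hpos : 0 < c.toReal := ENNReal.toReal_pos h0 hctop
  obtain ⟨h1, h2, h3⟩ := isEmbedding_expMu hμ hpos (by rwa [hcr]) fun R hR => by
    have := hS R hR
    rw [← hcr] at this
    exact (ENNReal.ofReal_lt_ofReal_iff_of_nonneg hpos.le).1 this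
  constructor
  · conv_lhs => rw [← hcr]
    exact le_iSup₂ (f := fun (r : ℝ) (_ : r ∈ {r : ℝ | D K r ⊆ W K μ ∧
      IsEmbedding ((D K r).domRestrict (expMu K μ))}) => ENNReal.ofReal r) c.toReal ⟨h1, h2⟩
  · conv_lhs => rw [← hcr]
    exact le_iSup₂ (f := fun (r : ℝ) (_ : r ∈ {r : ℝ | ∃ U : Set (E n × E n), U ⊆ W K μ ∧
      (∃ V : Set (E n × E n), IsOpen V ∧ U = D K r ∩ V) ∧ D K r ⊆ closure U ∧
      IsEmbedding (U.domRestrict (expMu K μ)) ∧ IsOpen (expMu K μ '' U)}) => ENNReal.ofReal r)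
      c.toReal ⟨D K c.toReal, h1, ⟨univ, isOpen_univ, (inter_univ _).symm⟩, subset_closure, h2, h3⟩

end LowerBound

/-! ### The upper bounds for `TIR` and `AIR`. -/

section UpperBound

variable {n : ℕ} {ι : Type*} {K : ClosedCurves n ι} {μ : E n → ℝ}

/-- A closed curve has normal vectors: by Rolle's theorem, some tangent is normal to a given one. -/
theorem exists_unit_normal (hμ : IsWeight K μ) (i : ι) (s : ℝ) :
    ∃ N : E n, ‖N‖ = 1 ∧ inner ℝ ((hμ.curve i).c1 s) N = 0 := by
  have hd : ∀ t, HasDerivAt (fun t => inner ℝ ((hμ.curve i).c1 s) (K.γ i t))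
      (inner ℝ ((hμ.curve i).c1 s) ((hμ.curve i).c1 t)) t := fun t => by
    have := (hasDerivAt_const t ((hμ.curve i).c1 s)).inner ℝ ((hμ.curve i).hc t)
    rw [inner_zero_left, add_zero] at this
    exact this
  obtain ⟨t, -, ht⟩ := exists_hasDerivAt_eq_zero (K.length_pos i)
    (fun t _ => (hd t).continuousAt.continuousWithinAt)
    (by rw [← zero_add (K.L i), K.periodic i]) (fun t _ => hd t)
  exact ⟨_, (hμ.curve i).unit_speed t, ht⟩

theorem exists_min_ratio_on (hμ : IsWeight K μ) (i : ι) (p : E n) :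
    ∃ s, (hμ.curve i).crit p s = 0 ∧ ∀ t, (hμ.curve i).ratio p s ≤ (hμ.curve i).ratio p t := by
  obtain ⟨s, -, hmin⟩ := isCompact_Icc.exists_isMinOn (nonempty_Icc.2 (K.length_pos i).le)
    (((hμ.curve i).cont_ratio_right p).continuousOn (s := Icc 0 (K.L i)))
  have hall : ∀ t, (hμ.curve i).ratio p s ≤ (hμ.curve i).ratio p t := fun t => by
    obtain ⟨t', ht', -, h⟩ := exists_mem_Icc hμ i t
    rw [← (h p).1]
    exact hmin ht'
  exact ⟨s, (hμ.curve i).crit_eq_zero_of_isLocalMin (Eventually.of_forall hall), hall⟩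

/-- The inequality defining `W` is closed and so passes from `U` to `D K r`. If `r |μ'| > 1`
somewhere, a normal vector there of length slightly below `r` violates it. -/
theorem admissible_of_dense [Finite ι] (hμ : IsWeight K μ) {r : ℝ} (hr : 0 < r)
    {U : Set (E n × E n)} (hUW : U ⊆ W K μ) (hd : D K r ⊆ closure U) : Admissible hμ r := by
  intro i s
  by_contra hn
  rw [not_le] at hn
  obtain ⟨N, hN, hN1⟩ := exists_unit_normal hμ i s
  have hc : Continuous fun R : ℝ => R ^ 2 * (hμ.curve i).m1 s ^ 2 := by fun_prop
  obtain ⟨R, ⟨hR, hRr⟩, hR0⟩ := (((hc.continuousAt.eventually (lt_mem_nhds hn)).filter_mono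
    nhdsWithin_le_nhds).and (Ioo_mem_nhdsLT hr)).exists.imp fun R h => (⟨⟨h.1, h.2.2⟩, h.2.1⟩ :
      (1 < R ^ 2 * (hμ.curve i).m1 s ^ 2 ∧ R < r) ∧ 0 < R)
  have hwn : ‖R • N‖ = R := by rw [norm_smul, hN, Real.norm_of_nonneg hR0.le, mul_one]
  have hx : (K.γ i s, R • N) ∈ D K r :=
    ⟨⟨i, s, rfl, by
      change inner ℝ ((hμ.curve i).c1 s) (R • N) = 0
      rw [inner_smul_right, hN1, mul_zero]⟩, by rwa [hwn]⟩
  have hg : ContinuousOn (fun x : E n × E n => ‖grad K μ x.1‖ ^ 2 * ‖x.2‖ ^ 2) (NK K) :=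
    ((continuousOn_grad hμ).norm.pow 2).mul (continuousOn_snd.norm.pow 2)
  have hle : ∀ y ∈ U, ‖grad K μ y.1‖ ^ 2 * ‖y.2‖ ^ 2 ≤ 1 := by
    intro y hy
    obtain ⟨j, t, h1, -⟩ := id (hUW hy).1
    have := (mem_W_iff hμ (hUW hy).1 h1).1 (hUW hy)
    rwa [← h1, norm_grad hμ, sq_abs]
  have := ((hg _ hx.1).mono fun y hy => (hUW hy).1).closure_le (hd hx)
    continuousWithinAt_const hle
  simp only at this
  rw [norm_grad hμ, sq_abs, hwn] at this
  linarith

/-- Every vector shorter than `r` realizes the weighted distance from its endpoint. -/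
def Minimizing (hμ : IsWeight K μ) (r : ℝ) : Prop :=
  ∀ x ∈ D K r, ∀ j t, ‖x.2‖ ≤ (hμ.curve j).ratio (expMu K μ x) t

theorem Minimizing.le_focRadMinus {hμ : IsWeight K μ} {r : ℝ} (hr : 0 < r)
    (h : Minimizing hμ r) (hadm : Admissible hμ r) : ENNReal.ofReal r ≤ focRadMinus K μ := by
  by_contra hn
  obtain ⟨i, s, hs⟩ := exists_of_focRadMinus_lt hμ hr (not_le.1 hn)
  rcases hs with hs | ⟨hd, hs⟩
  · exact absurd (hadm i s) (not_le.2 hs)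
  · obtain ⟨N, hN, hN1⟩ := exists_unit_normal hμ i s
    obtain ⟨w, hw, hwr, -, t, ht⟩ := (hμ.curve i).exists_not_min_of_focal hr hd hs hN hN1
    have := h (K.γ i s, w) ⟨⟨i, s, rfl, hw⟩, hwr⟩ i t
    rw [expMu_eq hμ] at this
    exact absurd this (not_le.2 ht)

/-- Otherwise the nearest point on some component would give a second preimage with a shorter
vector. -/
theorem minimizing_of_injOn {hμ : IsWeight K μ} {r : ℝ} (hadm : Admissible hμ r)
    (h : InjOn (expMu K μ) (D K r)) : Minimizing hμ r := by
  intro x hx j t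
  by_contra hn
  rw [not_le] at hn
  obtain ⟨s, hs, hmin⟩ := exists_min_ratio_on hμ j (expMu K μ x)
  have hlt := (hmin t).trans_lt hn
  obtain ⟨y, hy, -, hyn, hye⟩ := exists_expMu_eq hμ hadm hs (hlt.trans hx.2)
  rw [h hy hx hye] at hyn
  linarith

/-- The point of a double critical pair between its two points. -/
theorem IsDoubleCritical.exists_crit {i j : ι} {s t : ℝ} (h : IsDoubleCritical K μ i j s t)
    (hμ : IsWeight K μ) : ∃ p R, 0 < R ∧
      R = ‖K.γ i s - K.γ j t‖ / (wt K μ i s + wt K μ j t) ∧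
      (hμ.curve i).crit p s = 0 ∧ (hμ.curve i).ratio p s = R ∧
      (hμ.curve j).crit p t = 0 ∧ (hμ.curve j).ratio p t = R := by
  obtain ⟨hne, h1, h2⟩ := (isDoubleCritical_iff hμ i j s t).1 h
  have hmi : 0 < wt K μ i s := hμ.pos i s
  have hmj : 0 < wt K μ j t := hμ.pos j t
  have hM : 0 < wt K μ i s + wt K μ j t := add_pos hmi hmj
  have hn : 0 < ‖K.γ i s - K.γ j t‖ := norm_pos_iff.2 (sub_ne_zero.2 hne)
  set M := wt K μ i s + wt K μ j t with hMdef
  set p : E n := K.γ i s - (wt K μ i s / M) • (K.γ i s - K.γ j t) with hp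
  have d1 : p - K.γ i s = -(wt K μ i s / M) • (K.γ i s - K.γ j t) := by rw [hp]; module
  have d2 : p - K.γ j t = -(wt K μ j t / M) • (K.γ j t - K.γ i s) := by
    have : wt K μ i s / M = 1 - wt K μ j t / M := by
      rw [eq_sub_iff_add_eq, ← add_div, ← hMdef, div_self hM.ne']
    rw [hp, this]; module
  have e1 : M • (p - (hμ.curve i).c s) = -(hμ.curve i).m s • ((hμ.curve i).c s - K.γ j t) := by
    change M • (p - K.γ i s) = -wt K μ i s • (K.γ i s - K.γ j t)
    rw [d1, smul_smul]; congr 1; field_simp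
  have e2 : M • (p - (hμ.curve j).c t) = -(hμ.curve j).m t • ((hμ.curve j).c t - K.γ i s) := by
    change M • (p - K.γ j t) = -wt K μ j t • (K.γ j t - K.γ i s)
    rw [d2, smul_smul]; congr 1; field_simp
  refine ⟨p, _, div_pos hn hM, rfl, ?_, ?_, ?_, ?_⟩
  · rw [(hμ.curve i).crit_eq_pair hM.ne' e1]
    exact mul_eq_zero_of_right _ h1
  · change ‖p - K.γ i s‖ / wt K μ i s = _
    rw [d1, norm_smul, norm_neg, Real.norm_of_nonneg (by positivity)]
    field_simp
  · rw [(hμ.curve j).crit_eq_pair hM.ne' e2, hMdef, add_comm]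
    exact mul_eq_zero_of_right _ h2
  · change ‖p - K.γ j t‖ / wt K μ j t = _
    rw [d2, norm_smul, norm_neg, Real.norm_of_nonneg (by positivity), norm_sub_rev]
    field_simp

theorem exists_isDoubleCritical_lt {r : ℝ} (hr : 0 < r) (h : halfDCSD K μ < ENNReal.ofReal r) :
    ∃ i j s t, IsDoubleCritical K μ i j s t ∧
      ‖K.γ i s - K.γ j t‖ / (wt K μ i s + wt K μ j t) < r := by
  obtain ⟨i, h⟩ := iInf_lt_iff.1 h
  obtain ⟨j, h⟩ := iInf_lt_iff.1 h
  obtain ⟨s, h⟩ := iInf_lt_iff.1 h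
  obtain ⟨t, h⟩ := iInf_lt_iff.1 h
  obtain ⟨hd, h⟩ := iInf_lt_iff.1 h
  exact ⟨i, j, s, t, hd, (ENNReal.ofReal_lt_ofReal_iff hr).1 h⟩

theorem le_UR_of_injOn {hμ : IsWeight K μ} {r : ℝ} (hr : 0 < r) (hadm : Admissible hμ r)
    (h : InjOn (expMu K μ) (D K r)) : ENNReal.ofReal r ≤ UR K μ := by
  refine le_min ?_ ((minimizing_of_injOn hadm h).le_focRadMinus hr hadm)
  by_contra hn
  obtain ⟨i, j, s, t, hd, hlt⟩ := exists_isDoubleCritical_lt hr (not_le.1 hn)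
  obtain ⟨p, R, hR0, hR, c1, r1, c2, r2⟩ := hd.exists_crit hμ
  rw [← hR] at hlt
  obtain ⟨x, hx, hx1, -, hxe⟩ := exists_expMu_eq hμ hadm c1 (r1.trans_lt hlt)
  obtain ⟨y, hy, hy1, -, hye⟩ := exists_expMu_eq hμ hadm c2 (r2.trans_lt hlt)
  have := h hx hy (hxe.trans hye.symm)
  exact hd.1 (by rw [← hx1, ← hy1, this])

theorem TIR_le_UR [Finite ι] (hμ : IsWeight K μ) : TIR K μ ≤ UR K μ := by
  refine iSup₂_le fun r hr => ?_
  rcases le_or_gt r 0 with h0 | h0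
  · rw [ENNReal.ofReal_of_nonpos h0]; exact zero_le
  · exact le_UR_of_injOn h0 (admissible_of_dense hμ h0 hr.1 subset_closure)
      (injOn_iff_injective.2 hr.2.injective)

/-- Along an arc the exponential map is not injective. -/
theorem TIR_le_of_mem_arcRadii [Finite ι] (hμ : IsWeight K μ) {R : ℝ} (hR : R ∈ arcRadii K μ) :
    TIR K μ ≤ ENNReal.ofReal R := by
  obtain ⟨hR0, -, i, s₁, s₂, k, hlt, harc⟩ := (mem_arcRadii_iff hμ).1 hR
  refine iSup₂_le fun r hr => ?_
  by_contra hn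
  have hRr : R < r := by
    by_contra h
    exact hn (ENNReal.ofReal_le_ofReal (not_lt.1 h))
  have hadm := admissible_of_dense hμ (hR0.trans hRr) hr.1 subset_closure
  obtain ⟨p, hp⟩ := harc.exists_ratio_eq hR0
  have hcr : ∀ s ∈ Ioo s₁ s₂, (hμ.curve i).crit p s = 0 := by
    intro s hs
    refine (hμ.curve i).crit_eq_zero_of_isLocalMin ?_
    filter_upwards [Ioo_mem_nhds hs.1 hs.2] with t ht
    rw [hp t (Ioo_subset_Icc_self ht), hp s (Ioo_subset_Icc_self hs)]
  obtain ⟨u, hu1, hu2⟩ := exists_between hlt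
  -- The second parameter is taken within one period of the first, so the two points of `K` are
  -- distinct while their vectors have the same image.
  obtain ⟨v, hv1, hv2⟩ := exists_between (lt_min hu2 (lt_add_of_pos_right u (K.length_pos i)))
  obtain ⟨hv2, hv3⟩ := lt_min_iff.1 hv2
  have hu : u ∈ Ioo s₁ s₂ := ⟨hu1, hu2⟩
  have hv : v ∈ Ioo s₁ s₂ := ⟨hu1.trans hv1, hv2⟩
  obtain ⟨x, hx, hx1, -, hxe⟩ := exists_expMu_eq hμ hadm (hcr u hu)
    ((hp u (Ioo_subset_Icc_self hu)).trans_lt hRr)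
  obtain ⟨y, hy, hy1, -, hye⟩ := exists_expMu_eq hμ hadm (hcr v hv)
    ((hp v (Ioo_subset_Icc_self hv)).trans_lt hRr)
  have hxy := injOn_iff_injective.2 hr.2.injective hx hy (hxe.trans hye.symm)
  obtain ⟨m, hm⟩ := K.simple i u v (by rw [← hx1, ← hy1, hxy])
  have hL := K.length_pos i
  have h1 : (0 : ℝ) < m := by
    by_contra h
    have : (m : ℝ) * K.L i ≤ 0 := mul_nonpos_of_nonpos_of_nonneg (not_lt.1 h) hL.le
    linarith
  have h2 : (m : ℝ) < 1 := by
    by_contra h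
    have : K.L i ≤ m * K.L i := le_mul_of_one_le_left hL.le (not_lt.1 h)
    linarith
  have h1' : (0 : ℤ) < m := by exact_mod_cast h1
  have h2' : m < (1 : ℤ) := by exact_mod_cast h2
  omega

/-! ### The almost injectivity radius -/

/-- `U` witnesses that `exp^μ` is almost injective on `D(r)`. -/
structure AlmostInjective (K : ClosedCurves n ι) (μ : E n → ℝ) (r : ℝ) (U : Set (E n × E n)) :
    Prop where
  subset_W : U ⊆ W K μ
  subset_D : U ⊆ D K r
  dense : D K r ⊆ closure U
  embedding : IsEmbedding (U.domRestrict (expMu K μ))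
  isOpen : IsOpen (expMu K μ '' U)

/-- Almost injectivity fails if a point has a preimage in one open set and its neighbours have
preimages in a disjoint one. -/
theorem AlmostInjective.false_of_disjoint [Finite ι] (hμ : IsWeight K μ) {r : ℝ}
    {U : Set (E n × E n)} (h : AlmostInjective K μ r U) {N0 N1 : Set (E n × E n)}
    (h0 : IsOpen N0) (h1 : IsOpen N1) (h01 : ∀ x ∈ NK K, x ∈ N0 → x ∈ N1 → False)
    {x1 : E n × E n} (hx1 : x1 ∈ D K r) (hx1N : x1 ∈ N1)
    (hev : ∀ᶠ p in 𝓝 (expMu K μ x1), ∃ x ∈ D K r, x ∈ N0 ∧ expMu K μ x = p) : False := by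
  have hcont : ContinuousOn (expMu K μ) (D K r) := (continuousOn_expMu hμ).mono fun x hx => hx.1
  have hoe : IsOpenEmbedding (U.domRestrict (expMu K μ)) :=
    ⟨h.embedding, by rw [range_domRestrict]; exact h.isOpen⟩
  have hO : IsOpen (expMu K μ '' (U ∩ N1)) := by
    have := hoe.isOpenMap _ (h1.preimage continuous_subtype_val)
    convert this using 1
    ext p
    constructor
    · rintro ⟨x, ⟨hx, hxN⟩, rfl⟩
      exact ⟨⟨x, hx⟩, hxN, rfl⟩
    · rintro ⟨⟨x, hx⟩, hxN, rfl⟩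
      exact ⟨x, ⟨hx, hxN⟩, rfl⟩
  have hne : ∀ x ∈ D K r, (𝓝[U] x).NeBot := fun x hx =>
    mem_closure_iff_nhdsWithin_neBot.1 (h.dense hx)
  have hct : ∀ x ∈ D K r, Tendsto (expMu K μ) (𝓝[U] x) (𝓝 (expMu K μ x)) := fun x hx =>
    (hcont x hx).mono h.subset_D
  have := hne x1 hx1
  -- First approximation: a point `y` of `U` in `N1`, near `x1`, whose image has another preimage
  -- `x` in `N0`, possibly outside `U`.
  obtain ⟨y, ⟨x, hx, hxN, hxe⟩, hyU, hyN⟩ := (((hct x1 hx1).eventually hev).and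
    ((eventually_mem_nhdsWithin (s := U)).and
      (mem_nhdsWithin_of_mem_nhds (h1.mem_nhds hx1N)))).exists
  have := hne x hx
  -- Second approximation: a point `z` of `U` in `N0`, near `x`, whose image still lies in the open
  -- image of `U ∩ N1`. Injectivity on `U` then identifies points of `N0` and `N1`.
  obtain ⟨z, ⟨y', ⟨hy'U, hy'N⟩, hy'e⟩, hzU, hzN⟩ := (((hct x hx).eventually
    (hO.mem_nhds ⟨y, ⟨hyU, hyN⟩, hxe.symm⟩)).and
    ((eventually_mem_nhdsWithin (s := U)).and
      (mem_nhdsWithin_of_mem_nhds (h0.mem_nhds hxN)))).exists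
  have heq := injOn_iff_injective.2 h.embedding.injective hy'U hzU hy'e
  subst heq
  exact h01 _ (h.subset_D hy'U).1 hzN hy'N

/-- The two competing preimages are separated by the length of the vector, with a threshold strictly
between the two values. -/
theorem AlmostInjective.minimizing [Finite ι] {hμ : IsWeight K μ} {r : ℝ}
    {U : Set (E n × E n)} (h : AlmostInjective K μ r U) (hadm : Admissible hμ r) :
    Minimizing hμ r := by
  intro x hx j t
  by_contra hn
  obtain ⟨R, hR1, hR2⟩ := exists_between (not_le.1 hn)
  refine h.false_of_disjoint hμ (N0 := {x | ‖x.2‖ < R}) (N1 := {x | R < ‖x.2‖})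
    (isOpen_lt continuous_snd.norm continuous_const)
    (isOpen_lt continuous_const continuous_snd.norm)
    (fun y _ (h1 : ‖y.2‖ < R) (h2 : R < ‖y.2‖) => lt_asymm h1 h2) hx hR2 ?_
  filter_upwards [(isOpen_lt ((hμ.curve j).cont_ratio_left t) continuous_const).mem_nhds hR1]
    with p hp
  obtain ⟨s, hs, hmin⟩ := exists_min_ratio_on hμ j p
  have hlt := (hmin t).trans_lt hp
  obtain ⟨y, hy, -, hyn, hye⟩ := exists_expMu_eq hμ hadm hs (hlt.trans (hR2.trans hx.2))
  exact ⟨y, hy, hyn.trans_lt hlt, hye⟩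

/-- The version of `false_of_disjoint` for neighbourhoods defined by the base points. -/
theorem AlmostInjective.false_of_cover [Finite ι] (hμ : IsWeight K μ) {r : ℝ}
    {U : Set (E n × E n)} (h : AlmostInjective K μ r U) {A B : Set (E n)} (hA : IsClosed A)
    (hB : IsClosed B) (hAB : ∀ i s, K.γ i s ∈ A ∨ K.γ i s ∈ B)
    {x1 : E n × E n} (hx1 : x1 ∈ D K r) (hx1A : x1.1 ∉ A)
    (hev : ∀ᶠ p in 𝓝 (expMu K μ x1), ∃ x ∈ D K r, x.1 ∉ B ∧ expMu K μ x = p) : False := by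
  refine h.false_of_disjoint hμ (N0 := Prod.fst ⁻¹' Bᶜ) (N1 := Prod.fst ⁻¹' Aᶜ)
    (hB.isOpen_compl.preimage continuous_fst) (hA.isOpen_compl.preimage continuous_fst)
    ?_ hx1 hx1A hev
  rintro x ⟨i, s, hs, -⟩ h0 h1
  rcases hAB i s with h | h
  · exact h1 (hs ▸ h)
  · exact h0 (hs ▸ h)

/-- Between two points at which `ratio p` attains its minimum, and which `p` separates, `ratio p`
takes larger values. -/
theorem WeightedCurve.exists_ratio_gt {V : Type*} [NormedAddCommGroup V] [InnerProductSpace ℝ V]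
    (C : WeightedCurve V) {p : V} {a b R : ℝ} (hab : a < b) (hSF : C.SubFocal R)
    (hmin : ∀ t, R ≤ C.ratio p t) (ha : C.ratio p a = R) (hb : C.ratio p b = R)
    (hdist : R * (C.m a + C.m b) ≤ ‖C.c a - C.c b‖) : ∃ c ∈ Ioo a b, R < C.ratio p c := by
  by_contra! hn
  have hR : ∀ s ∈ Icc a b, C.ratio p s = R := by
    intro s hs
    rcases hs.1.eq_or_lt with rfl | h1
    · exact ha
    rcases hs.2.eq_or_lt with rfl | h2
    · exact hb
    exact le_antisymm (hn s ⟨h1, h2⟩) (hmin s)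
  have hcr : ∀ s ∈ Icc a b, C.crit p s = 0 := fun s hs =>
    C.crit_eq_zero_of_isLocalMin (Eventually.of_forall fun t => (hR s hs).trans_le (hmin t))
  obtain ⟨h0, k, hk⟩ := C.hasArc_of_crit_eq_zero hab hcr (by rwa [ha])
  rw [ha] at h0 hk
  exact absurd (hk.norm_sub_lt h0 hab.le) (not_lt.2 hdist)

theorem isClosed_other_components [Finite ι] (i : ι) :
    IsClosed (⋃ (j : ι) (_ : j ≠ i), range (K.γ j)) :=
  isClosed_iUnion_of_finite fun j => isClosed_iUnion_of_finite fun _ => isClosed_range_gamma j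

theorem notMem_other_components (i : ι) (s : ℝ) :
    K.γ i s ∉ ⋃ (j : ι) (_ : j ≠ i), range (K.γ j) := by
  simp only [mem_iUnion, not_exists]
  rintro j hj ⟨t, ht⟩
  exact hj (eq_of_gamma_eq ht).1

/-- The dividing point of a short double critical pair has two preimages of equal length, so they
are separated by base points. The neighbours of the image must keep a preimage away from the second
foot. Since arcs are allowed here, isolation of critical points is unavailable; a trapped minimum
replaces it. -/
theorem AlmostInjective.le_halfDCSD [Finite ι] (hμ : IsWeight K μ) {r : ℝ} (hr : 0 < r)
    {U : Set (E n × E n)} (h : AlmostInjective K μ r U) (hadm : Admissible hμ r) :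
    ENNReal.ofReal r ≤ halfDCSD K μ := by
  by_contra hn
  have hmz := h.minimizing hadm
  obtain ⟨i, j, s, t, hd, hlt⟩ := exists_isDoubleCritical_lt hr (not_le.1 hn)
  obtain ⟨p, R, hR0, hR, c1, r1, c2, r2⟩ := hd.exists_crit hμ
  rw [← hR] at hlt
  have hSF : ∀ i, (hμ.curve i).SubFocal R := subFocal_of_lt hμ hR0
    (((ENNReal.ofReal_lt_ofReal_iff hr).2 hlt).trans_le (hmz.le_focRadMinus hr hadm))
  have hevr : ∀ᶠ p' in 𝓝 p, (hμ.curve i).ratio p' s < r :=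
    (isOpen_lt ((hμ.curve i).cont_ratio_left s) continuous_const).mem_nhds (r1.trans_lt hlt)
  obtain ⟨x1, hx1, hx1b, hx1n, hx1e⟩ := exists_expMu_eq hμ hadm c2 (r2.trans_lt hlt)
  have hmin : ∀ k u, R ≤ (hμ.curve k).ratio p u := fun k u => by
    have := hmz x1 hx1 k u
    rwa [hx1n, hx1e, r2] at this
  rw [← hx1e] at hevr
  by_cases hij : i = j
  · subst hij
    have hL := K.length_pos i
    obtain ⟨k, hk, -⟩ := existsUnique_add_zsmul_mem_Ico hL t s
    have hγ : K.γ i (t + k • K.L i) = K.γ i t := (K.periodic i).zsmul k t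
    have hrt : (hμ.curve i).ratio p (t + k • K.L i) = R :=
      ((periodic_ratio hμ i p).zsmul k t).trans r2
    have hwt : wt K μ i (t + k • K.L i) = wt K μ i t := (periodic_wt i).zsmul k t
    set t' := t + k • K.L i
    have hst : s < t' := lt_of_le_of_ne hk.1 fun e => hd.1 (by rw [e, hγ])
    have hdist : R * (wt K μ i s + wt K μ i t) = ‖K.γ i s - K.γ i t‖ := by
      have : 0 < wt K μ i s + wt K μ i t := add_pos (hμ.pos i s) (hμ.pos i t)
      rw [hR, div_mul_cancel₀ _ this.ne']
    -- On both sides of the closed curve between the two feet the weighted distance exceeds `R`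
    -- somewhere. These barriers `c` and `d` trap a minimum in `(d - L, c)` for all nearby points.
    obtain ⟨c, hc, hcR⟩ := (hμ.curve i).exists_ratio_gt hst (hSF i) (hmin i) r1 hrt (by
      change R * (wt K μ i s + wt K μ i t') ≤ ‖K.γ i s - K.γ i t'‖
      rw [hwt, hγ, hdist])
    obtain ⟨d, hd', hdR⟩ := (hμ.curve i).exists_ratio_gt hk.2 (hSF i) (hmin i) hrt
      ((periodic_ratio hμ i p s).trans r1) (by
        change R * (wt K μ i t' + wt K μ i (s + K.L i)) ≤ ‖K.γ i t' - K.γ i (s + K.L i)‖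
        rw [hwt, hγ, periodic_wt i s, K.periodic i s, norm_sub_rev, ← hdist, add_comm])
    have hdL : (hμ.curve i).ratio p (d - K.L i) = (hμ.curve i).ratio p d :=
      (periodic_ratio hμ i p).sub_eq d
    have hev := (hμ.curve i).eventually_exists_crit (α := d - K.L i) (β := c) (s0 := s) (p0 := p)
      ⟨by linarith [hd'.2], hc.1⟩ (by rw [r1, hdL]; exact hdR) (by rw [r1]; exact hcR)
    rw [← hx1e] at hev
    have hstep : ∀ m : ℤ, (0 : ℝ) < m * K.L i → K.L i ≤ m * K.L i := fun m hm => by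
      have h1 : (0 : ℝ) < m := pos_of_mul_pos_left hm hL.le
      have h2 : (0 : ℤ) < m := by exact_mod_cast h1
      have h3 : (1 : ℝ) ≤ m := by exact_mod_cast h2
      exact le_mul_of_one_le_left hL.le h3
    -- The barriers cut the component into two closed arcs, one around each foot; the remaining
    -- components are added to the second.
    refine h.false_of_cover hμ (A := K.γ i '' Icc (d - K.L i) c)
      (B := K.γ i '' Icc c d ∪ ⋃ (j : ι) (_ : j ≠ i), range (K.γ j))
      (isCompact_Icc.image (continuous_gamma i)).isClosed
      ((isCompact_Icc.image (continuous_gamma i)).isClosed.union (isClosed_other_components i))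
      ?_ hx1 ?_ ?_
    · intro j u
      by_cases hj : j = i
      · subst hj
        obtain ⟨m, hm, -⟩ := existsUnique_add_zsmul_mem_Ico hL u (d - K.L j)
        rw [sub_add_cancel] at hm
        rw [← (K.periodic j).zsmul m u]
        rcases le_total (u + m • K.L j) c with h1 | h1
        · exact Or.inl ⟨_, ⟨hm.1, h1⟩, rfl⟩
        · exact Or.inr (Or.inl ⟨_, ⟨h1, hm.2.le⟩, rfl⟩)
      · exact Or.inr (Or.inr (mem_iUnion₂.2 ⟨j, hj, u, rfl⟩))
    · rintro ⟨u, hu, hue⟩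
      obtain ⟨-, m, hm⟩ := eq_of_gamma_eq (hue.trans (hx1b.trans hγ.symm))
      have h1 : (0 : ℝ) < m * K.L i := by linarith [hu.2, hc.2]
      have h2 := hstep m h1
      linarith [hu.1, hd'.1]
    · filter_upwards [hev, hevr] with p' ⟨s', hs', h1, h2⟩ h3
      obtain ⟨x, hx, hxb, -, hxe⟩ := exists_expMu_eq hμ hadm h1 (h2.trans_lt h3)
      refine ⟨x, hx, ?_, hxe⟩
      rw [hxb]
      rintro (⟨u, hu, hue⟩ | hu)
      · obtain ⟨-, m, hm⟩ := eq_of_gamma_eq hue.symm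
        have h1 : (0 : ℝ) < m * K.L i := by linarith [hu.1, hs'.2]
        have h2 := hstep m h1
        linarith [hu.2, hs'.1]
      · exact notMem_other_components i s' hu
  -- For feet on different components the components themselves separate them, and the nearest point
  -- on component `i` provides the persisting preimage.
  · refine h.false_of_cover hμ (A := range (K.γ i))
      (B := ⋃ (j : ι) (_ : j ≠ i), range (K.γ j)) (isClosed_range_gamma i)
      (isClosed_other_components i) ?_ hx1 ?_ ?_
    · intro k u
      by_cases hk : k = i
      · subst hk; exact Or.inl ⟨u, rfl⟩
      · exact Or.inr (mem_iUnion₂.2 ⟨k, hk, u, rfl⟩)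
    · rintro ⟨u, hu⟩
      exact hij (eq_of_gamma_eq (hu.trans hx1b)).1
    · filter_upwards [hevr] with p' h3
      obtain ⟨s', h1, h2⟩ := exists_min_ratio_on hμ i p'
      obtain ⟨x, hx, hxb, -, hxe⟩ := exists_expMu_eq hμ hadm h1 ((h2 s).trans_lt h3)
      exact ⟨x, hx, by rw [hxb]; exact notMem_other_components i s', hxe⟩

theorem AIR_le_UR [Finite ι] (hμ : IsWeight K μ) : AIR K μ ≤ UR K μ := by
  refine iSup₂_le fun r hr => ?_
  rcases le_or_gt r 0 with h0 | h0
  · rw [ENNReal.ofReal_of_nonpos h0]; exact zero_le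
  · obtain ⟨U, hW, ⟨V, -, hV⟩, hd, he, ho⟩ := hr
    have h : AlmostInjective K μ r U := ⟨hW, hV ▸ inter_subset_left, hd, he, ho⟩
    have hadm := admissible_of_dense hμ h0 hW hd
    exact le_min (h.le_halfDCSD hμ h0 hadm) ((h.minimizing hadm).le_focRadMinus h0 hadm)

end UpperBound

end NonuniformThickness

/-! ### The theorem, from the two bounds. -/

theorem theorem3 {n : ℕ} {ι : Type*} [Finite ι] (K : NonuniformThickness.ClosedCurves n ι)
    (μ : NonuniformThickness.E n → ℝ) (hμ : NonuniformThickness.IsWeight K μ) :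
    (NonuniformThickness.TIR K μ < NonuniformThickness.UR K μ →
      (NonuniformThickness.arcRadii K μ).Nonempty) ∧
    ((NonuniformThickness.arcRadii K μ).Nonempty →
      NonuniformThickness.TIR K μ =
        ⨅ r ∈ NonuniformThickness.arcRadii K μ, ENNReal.ofReal r) ∧
    (NonuniformThickness.arcRadii K μ = ∅ ↔
      ∀ i, interior (NonuniformThickness.compatibleSet K μ i) = ∅) ∧
    ((∀ i, interior (NonuniformThickness.compatibleSet K μ i) = ∅) →
      NonuniformThickness.TIR K μ = NonuniformThickness.AIR K μ ∧
      NonuniformThickness.AIR K μ = NonuniformThickness.UR K μ) := by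
  have hT : NonuniformThickness.arcRadii K μ = ∅ →
      NonuniformThickness.TIR K μ = NonuniformThickness.UR K μ ∧
      NonuniformThickness.AIR K μ = NonuniformThickness.UR K μ := by
    intro hS
    have h := fun (c : ℝ≥0∞) hc => NonuniformThickness.le_TIR_of_lt hμ (c := c) hc
      (fun R hR => by rw [hS] at hR; exact absurd hR (Set.notMem_empty R))
    exact ⟨le_antisymm (NonuniformThickness.TIR_le_UR hμ)
        (le_of_forall_lt_imp_le_of_dense fun c hc => (h c hc).1),
      le_antisymm (NonuniformThickness.AIR_le_UR hμ)
        (le_of_forall_lt_imp_le_of_dense fun c hc => (h c hc).2)⟩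
  refine ⟨fun h => ?_, fun h => ?_, NonuniformThickness.arcRadii_eq_empty_iff hμ, fun h => ?_⟩
  · rw [Set.nonempty_iff_ne_empty]
    intro hS
    exact h.ne (hT hS).1
  · refine le_antisymm
      (le_iInf₂ fun R hR => NonuniformThickness.TIR_le_of_mem_arcRadii hμ hR)
      (le_of_forall_lt_imp_le_of_dense fun c hc => ?_)
    -- Any arc radius is below `UR`, so a number below the infimum satisfies both hypotheses of
    -- `le_TIR_of_lt`.
    obtain ⟨R0, hR0⟩ := h
    have hlt : ∀ R ∈ NonuniformThickness.arcRadii K μ, c < ENNReal.ofReal R := fun R hR =>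
      hc.trans_le (iInf₂_le R hR)
    exact (NonuniformThickness.le_TIR_of_lt hμ ((hlt R0 hR0).trans hR0.2.1) hlt).1
  · obtain ⟨h1, h2⟩ := hT ((NonuniformThickness.arcRadii_eq_empty_iff hμ).2 h)
    exact ⟨h1.trans h2.symm, h2⟩
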